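/- Let $\mathbb{P}^1_{\mathbb{Q}}=\operatorname{Proj}\mathbb{Q}[x_0,x_1]$ and let $\operatorname{Aut}(\mathbb{P}^1_{\mathbb{Q}}\times\mathbb{P}^1_{\mathbb{Q}})$ be the group of automorphisms over $\mathbb{Q}$ of the surface $\mathbb{P}^1_{\mathbb{Q}}\times_{\operatorname{Spec}\mathbb{Q}}\mathbb{P}^1_{\mathbb{Q}}$. Every finite subgroup $G$ of $\operatorname{Aut}(\mathbb{P}^1_{\mathbb{Q}}\times\mathbb{P}^1_{\mathbb{Q}})$ satisfies $|G|\le 288$. The bound is attained. Let $D_6$ be the dihedral group of order $12$. There is an embedding $\rho\colon D_6\hookrightarrow\operatorname{Aut}(\mathbb{P}^1_{\mathbb{Q}})$ and an injective homomorphism $$\Phi\colon (D_6\times D_6)\rtimes\mathbb{Z}/2\mathbb{Z}\hookrightarrow\operatorname{Aut}(\mathbb{P}^1_{\mathbb{Q}}\times\mathbb{P}^1_{\mathbb{Q}}),$$ where the generator of $\mathbb{Z}/2\mathbb{Z}$ acts on $D_6\times D_6$ by exchanging the two factors, such that $\Phi(a,b)=\rho(a)\times\rho(b)$ for $(a,b)\in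 D_6\times D_6$ and $\Phi$ sends the generator of $\mathbb{Z}/2\mathbb{Z}$ to the exchange of the two factors of $\mathbb{P}^1_{\mathbb{Q}}\times\mathbb{P}^1_{\mathbb{Q}}$. The image of $\Phi$ is a finite subgroup of order $288$. -/

import Mathlib

open CategoryTheory CategoryTheory.Limits AlgebraicGeometry

noncomputable section

/-- The standard grading of the homogeneous coordinate ring `ℚ[x₀, x₁]` of the projective line:
the degree `n` part consists of the homogeneous polynomials of degree `n`. -/
abbrev coordGrading : ℕ → Submodule ℚ (MvPolynomial (Fin 2) ℚ) :=
  MvPolynomial.homogeneousSubmodule (Fin 2) ℚ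

instance coordGradedAlgebra : GradedAlgebra coordGrading :=
  MvPolynomial.gradedAlgebra

/-- The projective line `ℙ¹_ℚ = Proj ℚ[x₀, x₁]`, as a scheme over `Spec ℚ`. -/
def projLine : Over (Spec (CommRingCat.of ℚ)) :=
  Over.mk (Proj.toSpecZero coordGrading ≫
    Spec.map (CommRingCat.ofHom (algebraMap ℚ (coordGrading 0))))

/-- The surface `ℙ¹_ℚ × ℙ¹_ℚ`: the fibre product over `Spec ℚ`, as a scheme over `Spec ℚ`. -/
def projLineSq : Over (Spec (CommRingCat.of ℚ)) :=
  Over.mk (pullback.fst projLine.hom projLine.hom ≫ projLine.hom)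

/-- The projection of `ℙ¹_ℚ × ℙ¹_ℚ` to the first factor. -/
def projLineSqFst : projLineSq ⟶ projLine :=
  Over.homMk (pullback.fst projLine.hom projLine.hom) rfl

/-- The projection of `ℙ¹_ℚ × ℙ¹_ℚ` to the second factor. -/
def projLineSqSnd : projLineSq ⟶ projLine :=
  Over.homMk (pullback.snd projLine.hom projLine.hom) pullback.condition.symm

/-- The action of `ℤ/2` on `D × D` in which the generator exchanges the two factors. -/
def swapAction (D : Type) [Group D] : Multiplicative (ZMod 2) →* MulAut (D × D) where
  toFun t := if t = 1 then 1 else MulEquiv.prodComm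
  map_one' := by simp
  map_mul' s t := by
    have key : ∀ s t : Multiplicative (ZMod 2),
        (s = 1 ∧ s * t = t) ∨ (t = 1 ∧ s * t = s) ∨ (s ≠ 1 ∧ t ≠ 1 ∧ s * t = 1) := by decide
    rcases key s t with ⟨hs, h⟩ | ⟨ht, h⟩ | ⟨hs, ht, h⟩
    · rw [h]; simp [hs]
    · rw [h]; simp [ht]
    · rw [h]
      ext x <;> simp [hs, ht, MulAut.mul_apply]

/-- The group `(D₆ × D₆) ⋊ ℤ/2`, where `D₆` is the dihedral group of order `12` and `ℤ/2`
exchanges the two factors. -/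
abbrev dihedralSwapGroup : Type :=
  (DihedralGroup 6 × DihedralGroup 6) ⋊[swapAction (DihedralGroup 6)] Multiplicative (ZMod 2)

end

/-!
The automorphisms of `ℙ¹ × ℙ¹` over `ℚ` are bounded through their action on global vector fields.

*Upper bound.* Write `ℚ(s, t)` for the function field. The surface is covered by four affine planes
whose coordinate rings are the subrings `ℚ[s^±1, t^±1]` of `ℚ(s, t)`, one for each choice of signs,
so an automorphism is determined by the automorphism of `ℚ(s, t)` it induces
(`FieldAtlas.exists_action_on_field`). A derivation of `ℚ(s, t)` preserving the four coordinate
rings, that is, a global vector field, has the form `A(s) ∂/∂s + B(t) ∂/∂t` with `A`, `B` of degree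
at most two (`IsRegularDerivation.apply_coordFn_mem`). Preserving a coordinate ring is a condition
on the local rings, so automorphisms of the surface transport global vector fields to global vector
fields (`FieldAtlas.conj_derivation_mem_range`). Transporting the three fields `∂/∂s`, `s ∂/∂s`,
`s² ∂/∂s` by an automorphism `g` gives fields whose coefficients `A`, `φ A`, `φ² A` with `φ = g(s)`
are all quadratic in `s`, or all quadratic in `t`, with `A ≠ 0`. Comparing degrees, `φ` is a
fractional linear transform of `s` or of `t` (`exists_moebius_of_quadratic`). Hence a finite group
`G` of automorphisms permutes the two subfields `ℚ(s)` and `ℚ(t)`, and the kernel of this action, of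
index at most two, embeds into the product of two finite groups of fractional linear
transformations over `ℚ`.

A finite group of fractional linear transformations over `ℚ` has at most twelve elements
(`index_stabilizer_le_twelve`). It preserves a positive definite binary form up to scalars, so the
elements of positive determinant fix the root `τ` of the form in the upper half plane. They are
distinguished by the rotation factor `(c τ + d)² / det`, a root of unity whose real part is
rational, and a finite group of such roots of unity has order at most six. So
`|G| ≤ 2 * 12 * 12 = 288`.

*The bound is attained.* The matrices `!![2, -1; 1, 1]` and `!![0, 1; 1, 0]` generate a dihedral
group of order twelve in `PGL₂(ℚ)`, which acts on `ℙ¹` by linear substitutions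
(`exists_dihedralGroup_embedding`). Acting with it on both factors and exchanging the factors gives
a faithful action of the semidirect product (`wreathHom_injective`).
-/

/-! ### Finite groups of fractional linear transformations over `ℚ` -/

/-- `y = (a s + b) / (c s + d)`, where `M = !![a, b; c, d]`, with the denominator cleared. -/
def IsMoebiusImage {K : Type*} [Field K] (M : Matrix (Fin 2) (Fin 2) ℚ) (s y : K) : Prop :=
  y * ((M 1 0 : K) * s + (M 1 1 : K)) = (M 0 0 : K) * s + (M 0 1 : K)

/-- No nonzero quadratic polynomial over `ℚ` vanishes at `s`. -/
def IsQuadFree {K : Type*} [Field K] (s : K) : Prop :=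
  ∀ a b c : ℚ, (a : K) * s ^ 2 + (b : K) * s + (c : K) = 0 → a = 0 ∧ b = 0 ∧ c = 0

section Moebius

variable {K : Type*} [Field K] {s y : K} {M N : Matrix (Fin 2) (Fin 2) ℚ}

lemma IsQuadFree.den_ne_zero (hs : IsQuadFree s) (hM : M.det ≠ 0) :
    (M 1 0 : K) * s + (M 1 1 : K) ≠ 0 := by
  intro h
  obtain ⟨-, h1, h2⟩ := hs 0 (M 1 0) (M 1 1) (by simpa using h)
  exact hM (by rw [Matrix.det_fin_two, h1, h2]; ring)

/-- The matrix of a fractional linear transformation is unique up to a scalar. -/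
lemma IsMoebiusImage.exists_smul_eq [CharZero K] (hs : IsQuadFree s) (hM : M.det ≠ 0)
    (hN : N.det ≠ 0) (h1 : IsMoebiusImage M s y) (h2 : IsMoebiusImage N s y) :
    ∃ l : ℚ, l ≠ 0 ∧ N = l • M := by
  unfold IsMoebiusImage at h1 h2
  have hd := hs.den_ne_zero hM
  have hd' := hs.den_ne_zero hN
  obtain ⟨e1, e2, e3⟩ := hs (M 0 0 * N 1 0 - N 0 0 * M 1 0)
    (M 0 0 * N 1 1 + M 0 1 * N 1 0 - N 0 0 * M 1 1 - N 0 1 * M 1 0)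
    (M 0 1 * N 1 1 - N 0 1 * M 1 1) (by
      push_cast
      linear_combination (-(N 1 0 : K) * s - (N 1 1 : K)) * h1 +
        ((M 1 0 : K) * s + (M 1 1 : K)) * h2)
  set l := (M 1 1 * N 0 0 - M 0 1 * N 1 0) / M.det with hl
  have key : N = l • M := by
    have hdet := hM
    rw [Matrix.det_fin_two] at hdet
    have hl' : l * (M 0 0 * M 1 1 - M 0 1 * M 1 0) = M 1 1 * N 0 0 - M 0 1 * N 1 0 := by
      rw [hl, Matrix.det_fin_two, div_mul_cancel₀ _ hdet]
    ext i j
    refine mul_right_cancel₀ hdet ?_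
    rw [Matrix.smul_apply, smul_eq_mul, mul_right_comm, hl']
    fin_cases i <;> fin_cases j <;> simp only [Fin.zero_eta, Fin.mk_one, Fin.isValue]
    · linear_combination M 0 1 * e1
    · linear_combination M 0 1 * e2 - M 0 0 * e3
    · linear_combination M 1 1 * e1
    · linear_combination M 1 1 * e2 - M 1 0 * e3
  refine ⟨l, fun h0 ↦ hN ?_, key⟩
  rw [key, h0]; simp

variable {H : Type*} [Group H] [MulSemiringAction H K]

lemma smul_ratCast_of_mulSemiringAction (g : H) (q : ℚ) : g • (q : K) = q :=
  map_ratCast (MulSemiringAction.toRingHom H K g) q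

lemma IsMoebiusImage.smul {g h : H} [CharZero K] (hs : IsQuadFree s) (hM : M.det ≠ 0)
    (h1 : IsMoebiusImage M s (g • s)) (h2 : IsMoebiusImage N s (h • s)) :
    IsMoebiusImage (N * M) s ((g * h) • s) := by
  have hd := hs.den_ne_zero hM
  have h3 := congrArg (g • ·) h2
  unfold IsMoebiusImage at h1 ⊢
  simp only [smul_mul', smul_add, smul_ratCast_of_mulSemiringAction, ← mul_smul] at h3
  simp only [Matrix.mul_apply, Fin.sum_univ_two]
  push_cast
  linear_combination ((M 1 0 : K) * s + (M 1 1 : K)) * h3 +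
    ((N 0 0 : K) - (g * h) • s * (N 1 0 : K)) * h1

/-- The quadratic form `v ↦ |Nv|² / |det N|`, which depends on `N` only up to scalars. -/
def normalizedGram (N : Matrix (Fin 2) (Fin 2) ℚ) : Matrix (Fin 2) (Fin 2) ℚ :=
  |N.det|⁻¹ • (N.transpose * N)

lemma normalizedGram_smul {l : ℚ} (hl : l ≠ 0) : normalizedGram (l • N) = normalizedGram N := by
  rw [normalizedGram, normalizedGram, Matrix.det_smul]
  simp only [Fintype.card_fin, Matrix.transpose_smul, Matrix.smul_mul, Matrix.mul_smul, smul_smul,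
    abs_mul, abs_pow, sq_abs]
  congr 1
  rw [mul_inv]
  field_simp

lemma normalizedGram_mul (hM : M.det ≠ 0) :
    M.transpose * normalizedGram N * M = |M.det| • normalizedGram (N * M) := by
  rw [normalizedGram, normalizedGram, Matrix.det_mul, abs_mul, mul_inv, smul_smul,
    Matrix.transpose_mul]
  have : |M.det| ≠ 0 := abs_ne_zero.mpr hM
  rw [mul_comm |N.det|⁻¹, mul_inv_cancel_left₀ this]
  simp [Matrix.mul_assoc]

/-- A finite group of fractional linear transformations over `ℚ` preserves, up to the scalar
factor `|det|`, a positive definite quadratic form `p x² + 2 q x y + r y²`: the sum of the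
normalized Gram matrices of its elements. -/
lemma exists_invariant_form [CharZero K] [Finite H] (hs : IsQuadFree s)
    (M : H → Matrix (Fin 2) (Fin 2) ℚ) (hM : ∀ g, (M g).det ≠ 0)
    (hMs : ∀ g, IsMoebiusImage (M g) s (g • s)) :
    ∃ p q r : ℚ, 0 < p ∧ 0 < p * r - q ^ 2 ∧
      ∀ g, (M g).transpose * !![p, q; q, r] * M g = |(M g).det| • !![p, q; q, r] := by
  classical
  have := Fintype.ofFinite H
  set S : Matrix (Fin 2) (Fin 2) ℚ := ∑ h, normalizedGram (M h) with hS
  have hinv : ∀ g, (M g).transpose * S * M g = |(M g).det| • S := by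
    intro g
    rw [hS, Finset.mul_sum, Finset.sum_mul, Finset.smul_sum]
    refine Fintype.sum_equiv (Equiv.mulLeft g) _ _ fun h ↦ ?_
    rw [normalizedGram_mul (hM g)]
    obtain ⟨l, hl, e⟩ := IsMoebiusImage.exists_smul_eq hs
      (by rw [Matrix.det_mul]; exact mul_ne_zero (hM h) (hM g)) (hM (g * h))
      (IsMoebiusImage.smul hs (hM g) (hMs g) (hMs h)) (hMs (g * h))
    simp only [Equiv.coe_mulLeft]
    rw [e, normalizedGram_smul hl]
  have hsymm : S 1 0 = S 0 1 := by
    simp only [hS, Matrix.sum_apply, normalizedGram, Matrix.smul_apply, Matrix.mul_apply,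
      Matrix.transpose_apply]
    refine Finset.sum_congr rfl fun h _ ↦ ?_
    simp [mul_comm]
  have hpos : ∀ x y : ℚ, (x ≠ 0 ∨ y ≠ 0) →
      0 < S 0 0 * x ^ 2 + (S 0 1 + S 1 0) * x * y + S 1 1 * y ^ 2 := by
    intro x y hxy
    have : S 0 0 * x ^ 2 + (S 0 1 + S 1 0) * x * y + S 1 1 * y ^ 2 =
        ∑ h, |(M h).det|⁻¹ * ((M h 0 0 * x + M h 0 1 * y) ^ 2 +
          (M h 1 0 * x + M h 1 1 * y) ^ 2) := by
      simp only [hS, Matrix.sum_apply, ← Finset.sum_add_distrib, Finset.sum_mul]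
      refine Finset.sum_congr rfl fun h _ ↦ ?_
      simp only [normalizedGram, Matrix.smul_apply, Matrix.mul_apply,
        Matrix.transpose_apply, Fin.sum_univ_two, smul_eq_mul]
      ring
    rw [this]
    refine Finset.sum_pos (fun h _ ↦ mul_pos (inv_pos.mpr (abs_pos.mpr (hM h))) ?_)
      ⟨1, Finset.mem_univ _⟩
    by_contra hle
    have i1 := sq_nonneg (M h 0 0 * x + M h 0 1 * y)
    have i2 := sq_nonneg (M h 1 0 * x + M h 1 1 * y)
    have h1 : M h 0 0 * x + M h 0 1 * y = 0 := pow_eq_zero_iff two_ne_zero |>.mp (by linarith)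
    have h2 : M h 1 0 * x + M h 1 1 * y = 0 := pow_eq_zero_iff two_ne_zero |>.mp (by linarith)
    have hd := hM h
    rw [Matrix.det_fin_two] at hd
    rcases hxy with hx | hy
    · exact mul_ne_zero hd hx (by linear_combination M h 1 1 * h1 - M h 0 1 * h2)
    · exact mul_ne_zero hd hy (by linear_combination M h 0 0 * h2 - M h 1 0 * h1)
  have hp : 0 < S 0 0 := by simpa using hpos 1 0 (by simp)
  refine ⟨S 0 0, S 0 1, S 1 1, hp, ?_, ?_⟩
  · -- evaluate the form at `(-q, p)`
    have h := hpos (-S 0 1) (S 0 0) (Or.inr hp.ne')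
    rw [hsymm] at h
    exact pos_of_mul_pos_right (a := S 0 0) (by linarith) hp.le
  · have : !![S 0 0, S 0 1; S 0 1, S 1 1] = S := by
      ext i j; fin_cases i <;> fin_cases j <;> simp [hsymm]
    rw [this]
    exact hinv

/-- The automorphy factor `c τ + d` of a matrix `!![a, b; c, d]`. -/
def autFactor (τ : ℂ) (N : Matrix (Fin 2) (Fin 2) ℚ) : ℂ := (N 1 0 : ℂ) * τ + (N 1 1 : ℂ)

/-- The rotation factor `(c τ + d)² / det` of a fractional linear transformation fixing `τ`: the
inverse of its derivative at `τ`. -/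
noncomputable def rotFactor (τ : ℂ) (N : Matrix (Fin 2) (Fin 2) ℚ) : ℂ :=
  autFactor τ N ^ 2 / (N.det : ℂ)

lemma rotFactor_smul (τ : ℂ) {l : ℚ} (hl : l ≠ 0) : rotFactor τ (l • N) = rotFactor τ N := by
  have : (l : ℂ) ≠ 0 := by exact_mod_cast hl
  simp only [rotFactor, autFactor, Matrix.det_smul, Fintype.card_fin, Matrix.smul_apply,
    smul_eq_mul]
  push_cast
  field_simp

lemma rotFactor_mul (τ : ℂ)
    (h : (M 0 0 : ℂ) * τ + (M 0 1 : ℂ) = τ * ((M 1 0 : ℂ) * τ + (M 1 1 : ℂ))) :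
    rotFactor τ (N * M) = rotFactor τ N * rotFactor τ M := by
  have : autFactor τ (N * M) = autFactor τ N * autFactor τ M := by
    simp only [autFactor, Matrix.mul_apply, Fin.sum_univ_two]
    push_cast
    linear_combination (N 1 0 : ℂ) * h
  rw [rotFactor, rotFactor, rotFactor, this, Matrix.det_mul]
  push_cast
  rw [mul_pow, mul_div_mul_comm]

/-! ### The common fixed point and the rotation factors -/

/-- The root in the upper half plane of `p τ² + 2 q τ + r`. -/
noncomputable def formRoot (p q r : ℚ) : ℂ :=
  ⟨-q / p, Real.sqrt (p * r - q ^ 2) / p⟩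

lemma formRoot_im_ne_zero {p q r : ℚ} (hp : 0 < p) (hd : 0 < p * r - q ^ 2) :
    (formRoot p q r).im ≠ 0 := by
  have h1 : (0 : ℝ) < p := by exact_mod_cast hp
  have h2 : (0 : ℝ) < p * r - q ^ 2 := by exact_mod_cast hd
  exact div_ne_zero (Real.sqrt_pos.mpr h2).ne' h1.ne'

lemma formRoot_add_conj {p q r : ℚ} (hp : 0 < p) :
    p * (formRoot p q r + (starRingEnd ℂ) (formRoot p q r)) = -2 * q := by
  have h1 : (p : ℝ) ≠ 0 := by exact_mod_cast hp.ne'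
  apply Complex.ext <;> simp [formRoot]
  field_simp; ring

lemma formRoot_mul_conj {p q r : ℚ} (hp : 0 < p) (hd : 0 < p * r - q ^ 2) :
    p * (formRoot p q r * (starRingEnd ℂ) (formRoot p q r)) = r := by
  have h1 : (p : ℝ) ≠ 0 := by exact_mod_cast hp.ne'
  have h2 : (0 : ℝ) < p * r - q ^ 2 := by exact_mod_cast hd
  have h3 := Real.mul_self_sqrt h2.le
  apply Complex.ext <;> simp [formRoot]
  · field_simp
    linear_combination h3
  · ring_nf; simp

/-- An orientation preserving similitude of `p x² + 2 q x y + r y²` is determined by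
two of its entries. -/
lemma similitude_equations {p q r : ℚ} (hM : 0 < M.det)
    (h : M.transpose * !![p, q; q, r] * M = |M.det| • !![p, q; q, r]) :
    p * M 0 0 + q * M 1 0 = p * M 1 1 - q * M 1 0 ∧ p * M 0 1 = - (r * M 1 0) := by
  rw [abs_of_pos hM] at h
  have h2 : M.transpose * !![p, q; q, r] * (M * M.adjugate) =
      M.det • !![p, q; q, r] * M.adjugate := by rw [← h, Matrix.mul_assoc, Matrix.mul_assoc,
        Matrix.mul_assoc]
  rw [Matrix.mul_adjugate, Matrix.mul_smul, Matrix.mul_one, Matrix.smul_mul] at h2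
  have h3 := smul_right_injective _ hM.ne' h2
  have e00 := congrFun (congrFun h3 0) 0
  have e01 := congrFun (congrFun h3 0) 1
  simp [Matrix.mul_apply, Fin.sum_univ_two, Matrix.adjugate_fin_two] at e00 e01
  exact ⟨by linarith, by linarith⟩

/-- An orientation preserving similitude of a form fixes the root of the form. -/
lemma formRoot_fixed {p q r : ℚ} (hp : 0 < p) (hd : 0 < p * r - q ^ 2)
    (h1 : p * M 0 0 + q * M 1 0 = p * M 1 1 - q * M 1 0) (h2 : p * M 0 1 = - (r * M 1 0)) :
    (M 0 0 : ℂ) * formRoot p q r + (M 0 1 : ℂ) =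
      formRoot p q r * ((M 1 0 : ℂ) * formRoot p q r + (M 1 1 : ℂ)) := by
  have hp' : (p : ℂ) ≠ 0 := by exact_mod_cast hp.ne'
  have e1 := formRoot_add_conj (q := q) (r := r) hp
  have e2 := formRoot_mul_conj hp hd
  have h1' : (p * M 0 0 + q * M 1 0 : ℂ) = p * M 1 1 - q * M 1 0 := by exact_mod_cast h1
  have h2' : (p * M 0 1 : ℂ) = - (r * M 1 0) := by exact_mod_cast h2
  refine mul_left_cancel₀ hp' ?_
  linear_combination formRoot p q r * h1' + h2' - (M 1 0 : ℂ) * formRoot p q r * e1 +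
    (M 1 0 : ℂ) * e2

/-- The automorphy factor has half the trace of the matrix as real part, so the real part of the
rotation factor is rational. -/
lemma autFactor_add_conj {p q r : ℚ} (hp : 0 < p)
    (h1 : p * M 0 0 + q * M 1 0 = p * M 1 1 - q * M 1 0) :
    autFactor (formRoot p q r) M + (starRingEnd ℂ) (autFactor (formRoot p q r) M) =
      ((M 0 0 + M 1 1 : ℚ) : ℂ) := by
  have hp' : (p : ℂ) ≠ 0 := by exact_mod_cast hp.ne'
  have e1 := formRoot_add_conj (q := q) (r := r) hp
  have h1' : (p * M 0 0 + q * M 1 0 : ℂ) = p * M 1 1 - q * M 1 0 := by exact_mod_cast h1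
  refine mul_left_cancel₀ hp' ?_
  simp only [autFactor, map_add, map_mul, map_ratCast]
  push_cast
  linear_combination (M 1 0 : ℂ) * e1 - h1'

/-- The automorphy factor has norm `√det`, so the rotation factor lies on the unit circle. -/
lemma autFactor_mul_conj {p q r : ℚ} (hp : 0 < p) (hd : 0 < p * r - q ^ 2)
    (h1 : p * M 0 0 + q * M 1 0 = p * M 1 1 - q * M 1 0) (h2 : p * M 0 1 = - (r * M 1 0)) :
    autFactor (formRoot p q r) M * (starRingEnd ℂ) (autFactor (formRoot p q r) M) =
      (M.det : ℂ) := by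
  have hp' : (p : ℂ) ≠ 0 := by exact_mod_cast hp.ne'
  have e1 := formRoot_add_conj (q := q) (r := r) hp
  have e2 := formRoot_mul_conj hp hd
  have h1' : (p * M 0 0 + q * M 1 0 : ℂ) = p * M 1 1 - q * M 1 0 := by exact_mod_cast h1
  have h2' : (p * M 0 1 : ℂ) = - (r * M 1 0) := by exact_mod_cast h2
  refine mul_left_cancel₀ hp' ?_
  simp only [autFactor, map_add, map_mul, map_ratCast, Matrix.det_fin_two]
  push_cast
  linear_combination (M 1 0 : ℂ) ^ 2 * e2 + (M 1 0 : ℂ) * (M 1 1 : ℂ) * e1 - (M 1 1 : ℂ) * h1' +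
    (M 1 0 : ℂ) * h2'

/-- A finite subgroup of `ℂˣ` whose elements lie on the unit circle and have rational real part
has at most six elements: the trace `ζ + ζ̄` of a generator is an algebraic integer in `ℚ`, hence
one of `-2, -1, 0, 1, 2`. -/
lemma card_le_six_of_rational_trace (C : Subgroup ℂˣ) [Finite C]
    (h1 : ∀ z ∈ C, (z : ℂ) * (starRingEnd ℂ) z = 1)
    (h2 : ∀ z ∈ C, ∃ q : ℚ, (z : ℂ) + (starRingEnd ℂ) z = q) : Nat.card C ≤ 6 := by
  obtain ⟨⟨ζ, hζ⟩, hgen⟩ := IsCyclic.exists_generator (α := C)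
  have hcard : Nat.card C = orderOf ζ := by
    rw [← orderOf_eq_card_of_forall_mem_zpowers hgen, Subgroup.orderOf_mk]
  have hpos : 0 < orderOf ζ := by rw [← hcard]; exact Nat.card_pos
  have hpow : (ζ : ℂ) ^ orderOf ζ = 1 := by
    rw [← Units.val_pow_eq_pow_val, pow_orderOf_eq_one, Units.val_one]
  obtain ⟨q, hq⟩ := h2 ζ hζ
  have hn := h1 ζ hζ
  have hint : IsIntegral ℤ (ζ : ℂ) :=
    ⟨Polynomial.X ^ orderOf ζ - 1, Polynomial.monic_X_pow_sub_C (1 : ℤ) hpos.ne', by simp [hpow]⟩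
  have hint' : IsIntegral ℤ ((starRingEnd ℂ) (ζ : ℂ)) :=
    ⟨Polynomial.X ^ orderOf ζ - 1, Polynomial.monic_X_pow_sub_C (1 : ℤ) hpos.ne', by
      simp [← map_pow, hpow]⟩
  have hqi : IsIntegral ℤ (algebraMap ℚ ℂ q) := by
    have := hint.add hint'
    rw [hq] at this
    simpa using this
  rw [isIntegral_algebraMap_iff (algebraMap ℚ ℂ).injective] at hqi
  obtain ⟨k, hk⟩ := IsIntegrallyClosed.isIntegral_iff.mp hqi
  have hk' : (ζ : ℂ) + (starRingEnd ℂ) ζ = (k : ℂ) := by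
    rw [hq, ← hk]; simp
  have hquad : (ζ : ℂ) ^ 2 = k * ζ - 1 := by rw [← hk', ← hn]; ring
  have hre : 2 * (ζ : ℂ).re = k := by
    have := congrArg Complex.re hk'
    simp at this; linarith
  have hnorm : (ζ : ℂ).re ^ 2 + (ζ : ℂ).im ^ 2 = 1 := by
    have := congrArg Complex.re hn
    simp at this; nlinarith
  have hk2 : (k : ℝ) ^ 2 ≤ 4 := by rw [← hre]; nlinarith [sq_nonneg (ζ : ℂ).im]
  have hk3 : k ^ 2 ≤ 4 := by exact_mod_cast hk2
  have hk4 : -2 ≤ k := by nlinarith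
  have hk5 : k ≤ 2 := by nlinarith
  have hord : ∀ n : ℕ, 0 < n → n ≤ 6 → (ζ : ℂ) ^ n = 1 → Nat.card C ≤ 6 := by
    intro n hn0 hn6 h
    rw [hcard]
    exact (orderOf_le_of_pow_eq_one hn0 (Units.ext (by simpa using h))).trans hn6
  -- since `ζ² = k ζ - 1`, the order of `ζ` is `2`, `3`, `4`, `6` or `1`
  rcases (by omega : k = -2 ∨ k = -1 ∨ k = 0 ∨ k = 1 ∨ k = 2) with rfl | rfl | rfl | rfl | rfl
  · have : (ζ : ℂ) = -1 := by
      have : ((ζ : ℂ) + 1) ^ 2 = 0 := by push_cast at hquad; linear_combination hquad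
      linear_combination pow_eq_zero_iff two_ne_zero |>.mp this
    exact hord 2 (by norm_num) (by norm_num) (by rw [this]; norm_num)
  · exact hord 3 (by norm_num) (by norm_num)
      (by push_cast at hquad; linear_combination ((ζ : ℂ) - 1) * hquad)
  · exact hord 4 (by norm_num) (by norm_num)
      (by push_cast at hquad; linear_combination ((ζ : ℂ) ^ 2 - 1) * hquad)
  · exact hord 6 (by norm_num) (by norm_num)
      (by push_cast at hquad; linear_combination ((ζ : ℂ) ^ 3 - 1) * ((ζ : ℂ) + 1) * hquad)
  · have : (ζ : ℂ) = 1 := by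
      have : ((ζ : ℂ) - 1) ^ 2 = 0 := by push_cast at hquad; linear_combination hquad
      linear_combination pow_eq_zero_iff two_ne_zero |>.mp this
    exact hord 1 (by norm_num) (by norm_num) (by rw [this]; norm_num)

/-- If a finite group acts on a field so that every element moves `s` by a fractional linear
transformation over `ℚ`, then `s` has at most twelve conjugates: the orientation preserving
elements are rotations about a common fixed point in the upper half plane, and at most six rotation
angles are possible over `ℚ`. -/
theorem index_stabilizer_le_twelve [CharZero K] [Finite H] (hs : IsQuadFree s)
    (hH : ∀ g : H, ∃ M : Matrix (Fin 2) (Fin 2) ℚ, M.det ≠ 0 ∧ IsMoebiusImage M s (g • s)) :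
    (MulAction.stabilizer H s).index ≤ 12 := by
  classical
  choose M hM hMs using hH
  obtain ⟨p, q, r, hp, hd, hinv⟩ := exists_invariant_form hs M hM hMs
  have hmul : ∀ g h : H, ∃ l : ℚ, l ≠ 0 ∧ M (g * h) = l • (M h * M g) := fun g h ↦
    IsMoebiusImage.exists_smul_eq hs (by rw [Matrix.det_mul]; exact mul_ne_zero (hM h) (hM g))
      (hM (g * h)) (IsMoebiusImage.smul hs (hM g) (hMs g) (hMs h)) (hMs (g * h))
  have hsign : ∀ g h : H, SignType.sign (M (g * h)).det =
      SignType.sign (M g).det * SignType.sign (M h).det := by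
    intro g h
    obtain ⟨l, hl, e⟩ := hmul g h
    rw [e, Matrix.det_smul, Matrix.det_mul, sign_mul, sign_mul, mul_comm (SignType.sign (M h).det)]
    rw [Fintype.card_fin, sign_pos (by positivity), one_mul]
  let sgn : H →* SignTypeˣ := MonoidHom.mk' (fun g ↦ Units.mk0 (SignType.sign (M g).det)
    (sign_ne_zero.mpr (hM g))) fun g h ↦ Units.ext (by simpa using hsign g h)
  have hpos : ∀ g ∈ sgn.ker, 0 < (M g).det := by
    intro g hg
    have := congrArg Units.val (MonoidHom.mem_ker.mp hg)
    exact sign_eq_one_iff.mp this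
  set τ := formRoot p q r with hτ
  have heq : ∀ g ∈ sgn.ker, _ := fun g hg ↦ similitude_equations (hpos g hg) (hinv g)
  have hnorm : ∀ g ∈ sgn.ker, autFactor τ (M g) * (starRingEnd ℂ) (autFactor τ (M g)) =
      ((M g).det : ℂ) := fun g hg ↦ autFactor_mul_conj hp hd (heq g hg).1 (heq g hg).2
  have hrot0 : ∀ g ∈ sgn.ker, rotFactor τ (M g) ≠ 0 := by
    intro g hg h0
    have hdet : ((M g).det : ℂ) ≠ 0 := by exact_mod_cast hM g
    have h1 : autFactor τ (M g) = 0 := by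
      simpa [rotFactor, hdet] using h0
    have := hnorm g hg
    rw [h1, zero_mul] at this
    exact hdet this.symm
  let χ : sgn.ker →* ℂˣ := MonoidHom.mk' (fun g ↦ Units.mk0 (rotFactor τ (M g)) (hrot0 g g.2))
    fun g h ↦ Units.ext (by
      obtain ⟨l, hl, e⟩ := hmul g h
      have h1 := heq g g.2
      simp only [Subgroup.coe_mul, Units.val_mk0, Units.val_mul]
      rw [e, rotFactor_smul τ hl, rotFactor_mul τ (formRoot_fixed hp hd h1.1 h1.2), mul_comm])
  have hcard : Nat.card χ.range ≤ 6 := by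
    have : Finite χ.range := Finite.of_surjective _ χ.rangeRestrict_surjective
    refine card_le_six_of_rational_trace _ ?_ ?_
    · rintro _ ⟨g, rfl⟩
      have hdet : ((M g).det : ℂ) ≠ 0 := by exact_mod_cast hM g
      change rotFactor τ (M g) * (starRingEnd ℂ) (rotFactor τ (M g)) = 1
      simp only [rotFactor, map_div₀, map_pow, map_ratCast]
      rw [div_mul_div_comm, ← mul_pow, hnorm g g.2, sq, div_self (mul_ne_zero hdet hdet)]
    · rintro _ ⟨g, rfl⟩
      have hdet : ((M g).det : ℂ) ≠ 0 := by exact_mod_cast hM g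
      refine ⟨((M g 0 0 + M g 1 1) ^ 2 - 2 * (M g).det) / (M g).det, ?_⟩
      change rotFactor τ (M g) + (starRingEnd ℂ) (rotFactor τ (M g)) = _
      have h1 := autFactor_add_conj (r := r) hp (heq g g.2).1
      have h2 := hnorm g g.2
      simp only [rotFactor, map_div₀, map_pow, map_ratCast]
      rw [Rat.cast_div, Rat.cast_sub, Rat.cast_mul, Rat.cast_pow, Rat.cast_ofNat, ← h1, ← h2]
      rw [← h2] at hdet
      field_simp
      ring
  -- a transformation with rotation factor one is trivial
  have hker : χ.ker.map sgn.ker.subtype ≤ MulAction.stabilizer H s := by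
    rintro _ ⟨g, hg, rfl⟩
    have hdet : ((M g).det : ℂ) ≠ 0 := by exact_mod_cast hM g
    have h1 : rotFactor τ (M g) = 1 := congrArg Units.val (MonoidHom.mem_ker.mp hg)
    rw [rotFactor, div_eq_one_iff_eq hdet, ← hnorm g g.2, sq] at h1
    have hne : autFactor τ (M g) ≠ 0 := by
      intro h0
      have := hnorm g g.2
      rw [h0, zero_mul] at this
      exact hdet this.symm
    -- the automorphy factor is real, so the lower left entry of the matrix vanishes
    have h3 := mul_left_cancel₀ hne h1
    have h4 := congrArg Complex.im h3
    simp only [autFactor, Complex.conj_im, Complex.add_im, Complex.mul_im, Complex.ratCast_re,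
      Complex.ratCast_im] at h4
    have h5 : (M g 1 0 : ℝ) = 0 := by
      have : (M g 1 0 : ℝ) * τ.im = 0 := by linarith
      exact (mul_eq_zero.mp this).resolve_right (formRoot_im_ne_zero hp hd)
    have hc : M g 1 0 = 0 := by exact_mod_cast h5
    obtain ⟨e1, e2⟩ := heq g g.2
    rw [hc] at e1 e2
    have ha : M g 0 0 = M g 1 1 := mul_left_cancel₀ hp.ne' (by linarith)
    have hb : M g 0 1 = 0 := by
      have : p * M g 0 1 = 0 := by linarith
      exact (mul_eq_zero.mp this).resolve_left hp.ne'
    have hm := hMs g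
    have hd0 := hs.den_ne_zero (hM g)
    rw [IsMoebiusImage, hc, hb, ha] at hm
    rw [hc] at hd0
    simp only [Rat.cast_zero, zero_mul, zero_add, add_zero] at hm hd0
    rw [mul_comm] at hm
    exact mul_left_cancel₀ hd0 hm
  have hidx : (χ.ker.map sgn.ker.subtype).index ≤ 12 := by
    rw [Subgroup.index_map_subtype, Subgroup.index_ker, Subgroup.index_ker]
    have : Nat.card sgn.range ≤ 2 := (Subgroup.card_le_card_group _).trans (by
      rw [Nat.card_eq_fintype_card]; decide)
    calc _ ≤ 6 * 2 := Nat.mul_le_mul hcard this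
      _ = 12 := rfl
  exact (Nat.le_of_dvd (Nat.pos_of_ne_zero Subgroup.index_ne_zero_of_finite)
    (Subgroup.index_dvd_of_le hker)).trans hidx

end Moebius

/-! ### Regular vector fields on the surface, in coordinates -/

/-- The coordinate ring `ℚ[s, t]` of a standard affine chart of `ℙ¹ × ℙ¹`. -/
abbrev PlaneRing : Type := MvPolynomial (Fin 2) ℚ

/-- The function field `ℚ(s, t)` of `ℙ¹ × ℙ¹`. -/
def PlaneField : Type := FractionRing PlaneRing

noncomputable instance : Field PlaneField := inferInstanceAs (Field (FractionRing PlaneRing))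

noncomputable instance : Algebra PlaneRing PlaneField :=
  inferInstanceAs (Algebra PlaneRing (FractionRing PlaneRing))

instance : IsFractionRing PlaneRing PlaneField :=
  inferInstanceAs (IsFractionRing PlaneRing (FractionRing PlaneRing))

instance : CharZero PlaneField :=
  charZero_of_injective_algebraMap (IsFractionRing.injective PlaneRing PlaneField)

instance : IsScalarTower ℚ PlaneRing PlaneField :=
  IsScalarTower.of_algebraMap_eq' (Subsingleton.elim _ _)

/-- The coordinate functions `s` (for `i = 0`) and `t` (for `i = 1`). -/
noncomputable def coordFn (i : Fin 2) : PlaneField := algebraMap PlaneRing PlaneField (.X i)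

/-- The exponent of the affine coordinate on the chart `x_i ≠ 0` of the projective line: the
coordinate is `x₁ / x₀` for `i = 0` and its inverse for `i = 1`. -/
def chartSign (i : Fin 2) : ℤ := if i = 0 then 1 else -1

/-- The coordinate ring of the chart `x_{e 0} ≠ 0`, `y_{e 1} ≠ 0` of `ℙ¹ × ℙ¹`, embedded into the
function field. -/
noncomputable def chartHom (e : Fin 2 → Fin 2) : PlaneRing →ₐ[ℚ] PlaneField :=
  MvPolynomial.aeval fun i ↦ coordFn i ^ chartSign (e i)

/-- The Laurent monomial `s ^ (v 0) * t ^ (v 1)`. -/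
noncomputable def laurentMonomial (v : Fin 2 → ℤ) : PlaneField := ∏ i, coordFn i ^ v i

lemma coordFn_ne_zero (i : Fin 2) : coordFn i ≠ 0 := by
  rw [coordFn, Ne, IsFractionRing.to_map_eq_zero_iff]
  exact MvPolynomial.X_ne_zero i

lemma laurentMonomial_add (v w : Fin 2 → ℤ) :
    laurentMonomial (v + w) = laurentMonomial v * laurentMonomial w := by
  simp only [laurentMonomial, Pi.add_apply, zpow_add₀ (coordFn_ne_zero _), Finset.prod_mul_distrib]

lemma laurentMonomial_single (i : Fin 2) (k : ℤ) :
    laurentMonomial (Pi.single i k) = coordFn i ^ k := by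
  rw [laurentMonomial, Finset.prod_eq_single i]
  · simp
  · intro j _ hj; simp [hj]
  · simp

lemma laurentMonomial_natCast (m : Fin 2 →₀ ℕ) :
    laurentMonomial (fun i ↦ (m i : ℤ)) =
      algebraMap PlaneRing PlaneField (MvPolynomial.monomial m 1) := by
  rw [MvPolynomial.monomial_eq, map_mul, Finsupp.prod_fintype _ _ (by simp), map_prod]
  simp [laurentMonomial, coordFn]

/-- Laurent monomials are linearly independent: multiply by a large monomial to make all the
exponents that occur nonnegative. -/
lemma linearIndependent_laurentMonomial : LinearIndependent ℚ laurentMonomial := by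
  rw [linearIndependent_iff']
  intro S g hg v hv
  obtain ⟨N, hN⟩ : ∃ N : ℕ, ∀ w ∈ S, ∀ i, 0 ≤ w i + N := by
    refine ⟨∑ w ∈ S, ∑ i, (w i).natAbs, fun w hw i ↦ ?_⟩
    have h1 : (w i).natAbs ≤ ∑ i, (w i).natAbs :=
      Finset.single_le_sum (f := fun i ↦ (w i).natAbs) (by simp) (Finset.mem_univ i)
    have h2 : ∑ i, (w i).natAbs ≤ ∑ w ∈ S, ∑ i, (w i).natAbs :=
      Finset.single_le_sum (f := fun w : Fin 2 → ℤ ↦ ∑ i, (w i).natAbs) (by simp) hw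
    omega
  let m : (Fin 2 → ℤ) → (Fin 2 →₀ ℕ) :=
    fun w ↦ Finsupp.equivFunOnFinite.symm fun i ↦ (w i + N).toNat
  have hm : ∀ w ∈ S, laurentMonomial w * laurentMonomial (fun _ ↦ (N : ℤ)) =
      algebraMap PlaneRing PlaneField (MvPolynomial.monomial (m w) 1) := by
    intro w hw
    rw [← laurentMonomial_add, ← laurentMonomial_natCast]
    congr 1
    funext i
    simp [m, Int.toNat_of_nonneg (hN w hw i)]
  have h0 : ∑ w ∈ S, g w • MvPolynomial.monomial (m w) (1 : ℚ) = 0 := by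
    apply IsFractionRing.injective PlaneRing PlaneField
    rw [map_sum, map_zero, ← zero_mul (laurentMonomial fun _ ↦ (N : ℤ)), ← hg, Finset.sum_mul]
    refine Finset.sum_congr rfl fun w hw ↦ ?_
    rw [smul_mul_assoc, hm w hw, ← Algebra.linearMap_apply, ← Algebra.linearMap_apply]
    exact ((Algebra.linearMap PlaneRing PlaneField).restrictScalars ℚ).map_smul _ _
  have h1 := congrArg (MvPolynomial.coeff (m v)) h0
  rw [MvPolynomial.coeff_sum, Finset.sum_eq_single v] at h1
  · simpa using h1
  · intro w hw hwv
    rw [MvPolynomial.coeff_smul, MvPolynomial.coeff_monomial, if_neg, smul_zero]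
    intro h
    apply hwv
    funext i
    have := DFunLike.congr_fun h i
    simp [m] at this
    have h2 := hN w hw i
    have h3 := hN v hv i
    omega
  · exact fun h ↦ (h hv).elim

/-- The span of the Laurent monomials with exponents in `S`. -/
noncomputable def laurentSpan (S : Set (Fin 2 → ℤ)) : Submodule ℚ PlaneField :=
  Submodule.span ℚ (laurentMonomial '' S)

lemma laurentSpan_inf (S T : Set (Fin 2 → ℤ)) :
    laurentSpan S ⊓ laurentSpan T = laurentSpan (S ∩ T) := by
  have hinj : Function.Injective (Finsupp.linearCombination ℚ laurentMonomial) :=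
    linearIndependent_laurentMonomial
  simp only [laurentSpan, Finsupp.span_image_eq_map_linearCombination]
  rw [Finsupp.supported_inter, Submodule.map_inf _ hinj]

lemma mul_mem_laurentSpan (w : Fin 2 → ℤ) {S T : Set (Fin 2 → ℤ)} (h : ∀ v ∈ S, w + v ∈ T)
    {f : PlaneField} (hf : f ∈ laurentSpan S) : laurentMonomial w * f ∈ laurentSpan T := by
  induction hf using Submodule.span_induction with
  | mem x hx =>
    obtain ⟨v, hv, rfl⟩ := hx
    rw [← laurentMonomial_add]
    exact Submodule.subset_span ⟨_, h v hv, rfl⟩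
  | zero => rw [mul_zero]; exact zero_mem _
  | add x y _ _ hx hy => rw [mul_add]; exact add_mem hx hy
  | smul a x _ hx => rw [mul_smul_comm]; exact Submodule.smul_mem _ _ hx

lemma chartHom_monomial (e : Fin 2 → Fin 2) (m : Fin 2 →₀ ℕ) :
    chartHom e (MvPolynomial.monomial m 1) = laurentMonomial fun i ↦ chartSign (e i) * m i := by
  rw [chartHom, MvPolynomial.aeval_monomial, map_one, one_mul, Finsupp.prod_fintype _ _ (by simp)]
  simp [laurentMonomial, zpow_mul]

lemma chartSign_mul_self (i : Fin 2) : chartSign i * chartSign i = 1 := by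
  unfold chartSign; split_ifs <;> norm_num

lemma mem_range_chartHom_iff (e : Fin 2 → Fin 2) (f : PlaneField) :
    f ∈ (chartHom e).range ↔ f ∈ laurentSpan {v | ∀ i, 0 ≤ chartSign (e i) * v i} := by
  have : Subalgebra.toSubmodule (chartHom e).range =
      laurentSpan {v | ∀ i, 0 ≤ chartSign (e i) * v i} := by
    change LinearMap.range (chartHom e).toLinearMap = _
    rw [LinearMap.range_eq_map, ← (MvPolynomial.basisMonomials (Fin 2) ℚ).span_eq,
      Submodule.map_span, laurentSpan, ← Set.range_comp]
    congr 1
    ext y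
    constructor
    · rintro ⟨m, rfl⟩
      refine ⟨fun i ↦ chartSign (e i) * m i, fun i ↦ ?_, ?_⟩
      · change 0 ≤ chartSign (e i) * (chartSign (e i) * (m i : ℤ))
        rw [← mul_assoc, chartSign_mul_self]; positivity
      · simp [chartHom_monomial]
    · rintro ⟨v, hv, rfl⟩
      refine ⟨Finsupp.equivFunOnFinite.symm fun i ↦ (chartSign (e i) * v i).toNat, ?_⟩
      simp only [Function.comp_apply, MvPolynomial.coe_basisMonomials, AlgHom.toLinearMap_apply,
        chartHom_monomial, Finsupp.equivFunOnFinite_symm_apply_apply]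
      congr 1
      funext i
      rw [Int.toNat_of_nonneg (hv i), ← mul_assoc, chartSign_mul_self, one_mul]
  rw [← this]; rfl

lemma chartHom_injective (e : Fin 2 → Fin 2) : Function.Injective (chartHom e) := by
  have h1 : LinearIndependent ℚ fun m : Fin 2 →₀ ℕ ↦
      laurentMonomial fun i ↦ chartSign (e i) * m i := by
    refine linearIndependent_laurentMonomial.comp _ fun m m' h ↦ ?_
    ext i
    have h2 := congrArg (chartSign (e i) * ·) (congrFun h i)
    simpa only [← mul_assoc, chartSign_mul_self, one_mul, Nat.cast_inj] using h2
  rw [injective_iff_map_eq_zero]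
  intro p hp
  rw [linearIndependent_iff'] at h1
  have h2 : ∑ m ∈ p.support, p.coeff m • laurentMonomial (fun i ↦ chartSign (e i) * m i) = 0 := by
    rw [← hp]
    conv_rhs => rw [← MvPolynomial.support_sum_monomial_coeff p, map_sum]
    refine Finset.sum_congr rfl fun m _ ↦ ?_
    rw [← chartHom_monomial, ← map_smul, MvPolynomial.smul_monomial, smul_eq_mul, mul_one]
  ext m
  by_cases hm : m ∈ p.support
  · exact h1 _ _ h2 m hm
  · simpa using hm

/-- A derivation of the function field is regular if it preserves the coordinate rings of the four
standard charts, that is, if it is a global vector field on `ℙ¹ × ℙ¹`. -/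
def IsRegularDerivation (D : Derivation ℚ PlaneField PlaneField) : Prop :=
  ∀ e : Fin 2 → Fin 2, ∀ f ∈ (chartHom e).range, D f ∈ (chartHom e).range

lemma chartHom_X (e : Fin 2 → Fin 2) (i : Fin 2) :
    chartHom e (.X i) = coordFn i ^ chartSign (e i) := by
  rw [chartHom, MvPolynomial.aeval_X]

lemma isRegularDerivation_of_forall_X (D : Derivation ℚ PlaneField PlaneField)
    (h : ∀ (e : Fin 2 → Fin 2) i, D (coordFn i ^ chartSign (e i)) ∈ (chartHom e).range) :
    IsRegularDerivation D := by
  rintro e _ ⟨p, rfl⟩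
  change D (chartHom e p) ∈ (chartHom e).range
  induction p using MvPolynomial.induction_on with
  | C a =>
    rw [MvPolynomial.algHom_C, Derivation.map_algebraMap]
    exact zero_mem _
  | add p q hp hq =>
    rw [map_add, map_add]; exact add_mem hp hq
  | mul_X p i hp =>
    rw [map_mul, Derivation.leibniz, smul_eq_mul, smul_eq_mul, chartHom_X]
    refine add_mem (mul_mem ⟨p, rfl⟩ (h e i)) (mul_mem ⟨.X i, ?_⟩ hp)
    exact chartHom_X e i

/-- A regular vector field is given by quadratic polynomials: `D s` is a quadratic polynomial in
`s` and `D t` is a quadratic polynomial in `t`. -/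
lemma IsRegularDerivation.apply_coordFn_mem {D : Derivation ℚ PlaneField PlaneField}
    (hD : IsRegularDerivation D) (i : Fin 2) :
    ∃ a b c : ℚ, D (coordFn i) = a • coordFn i ^ 2 + b • coordFn i + algebraMap ℚ _ c := by
  have h1 : ∀ e : Fin 2 → Fin 2, e i = 0 →
      D (coordFn i) ∈ laurentSpan {v | ∀ j, 0 ≤ chartSign (e j) * v j} := by
    intro e he
    rw [← mem_range_chartHom_iff]
    refine hD e _ ⟨.X i, ?_⟩
    exact (chartHom_X e i).trans (by rw [he]; simp [chartSign])
  have h2 : ∀ e : Fin 2 → Fin 2, e i = 1 →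
      D (coordFn i) ∈ laurentSpan {v | v i ≤ 2} := by
    intro e he
    have h3 : D (coordFn i)⁻¹ ∈ (chartHom e).range := by
      refine hD e _ ⟨.X i, ?_⟩
      exact (chartHom_X e i).trans (by rw [he]; simp [chartSign])
    rw [mem_range_chartHom_iff, Derivation.leibniz_inv] at h3
    have h4 := Submodule.neg_mem _ (mul_mem_laurentSpan (Pi.single i 2) (T := {v | v i ≤ 2}) (by
      intro v hv
      have := hv i
      rw [he] at this
      simp [chartSign] at this
      simpa using this) h3)
    rw [laurentMonomial_single] at h4
    convert h4 using 1
    have := coordFn_ne_zero i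
    simp only [smul_eq_mul]
    field_simp
  have h5 := Submodule.mem_inf.mpr ⟨Submodule.mem_inf.mpr
    ⟨h1 (fun _ ↦ 0) rfl, h1 (fun j ↦ if j = i then 0 else 1) (by simp)⟩, h2 (fun _ ↦ 1) rfl⟩
  rw [laurentSpan_inf, laurentSpan_inf] at h5
  have h6 : laurentSpan (({v | ∀ j, 0 ≤ chartSign 0 * v j} ∩
      {v | ∀ j, 0 ≤ chartSign (if j = i then 0 else 1) * v j}) ∩ {v | v i ≤ 2}) ≤
      Submodule.span ℚ {coordFn i ^ 2, coordFn i, 1} := by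
    refine Submodule.span_le.mpr ?_
    rintro _ ⟨v, ⟨⟨hv1, hv2⟩, hv3⟩, rfl⟩
    have hv : v = Pi.single i (v i) := by
      funext j
      by_cases hj : j = i
      · subst hj; simp
      · have i1 := hv1 j
        have i2 := hv2 j
        simp [chartSign, hj] at i1 i2
        simp [hj]
        omega
    have i1 := hv1 i
    have i3 : v i ≤ 2 := hv3
    simp [chartSign] at i1
    rw [hv, laurentMonomial_single]
    rcases (by omega : v i = 0 ∨ v i = 1 ∨ v i = 2) with h | h | h <;> rw [h] <;>
      refine Submodule.subset_span ?_ <;> simp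
  have h7 := h6 h5
  simp only [Submodule.mem_span_insert, Submodule.mem_span_singleton] at h7
  obtain ⟨a, _, ⟨b, _, ⟨c, rfl⟩, rfl⟩, h⟩ := h7
  exact ⟨a, b, c, by rw [h, Algebra.algebraMap_eq_smul_one, add_assoc]⟩

/-! ### The partial derivatives of the function field -/

/-- The homomorphism `f(x) ↦ f(x + ε e_i)` from `ℚ[s, t]` to the dual numbers over `ℚ(s, t)`. -/
noncomputable def infinitesimalShift (i : Fin 2) :
    PlaneRing →ₐ[ℚ] TrivSqZeroExt PlaneField PlaneField :=
  MvPolynomial.aeval fun j ↦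
    TrivSqZeroExt.inl (coordFn j) + if j = i then TrivSqZeroExt.inr 1 else 0

lemma fst_infinitesimalShift (i : Fin 2) (p : PlaneRing) :
    (infinitesimalShift i p).fst = algebraMap PlaneRing PlaneField p := by
  induction p using MvPolynomial.induction_on with
  | C a =>
    rw [MvPolynomial.algHom_C, TrivSqZeroExt.algebraMap_eq_inl', TrivSqZeroExt.fst_inl,
      ← MvPolynomial.algebraMap_eq, ← IsScalarTower.algebraMap_apply]
  | add p q hp hq => rw [map_add, map_add, TrivSqZeroExt.fst_add, hp, hq]
  | mul_X p j hp =>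
    rw [map_mul, map_mul, TrivSqZeroExt.fst_mul, hp, infinitesimalShift, MvPolynomial.aeval_X]
    split_ifs <;> simp [coordFn]

/-- The extension of `infinitesimalShift` to the function field. -/
noncomputable def infinitesimalShiftField (i : Fin 2) :
    PlaneField →ₐ[ℚ] TrivSqZeroExt PlaneField PlaneField :=
  IsLocalization.liftAlgHom (M := nonZeroDivisors PlaneRing) (f := infinitesimalShift i) fun p ↦ by
    rw [TrivSqZeroExt.isUnit_iff_isUnit_fst, fst_infinitesimalShift, isUnit_iff_ne_zero, Ne,
      IsFractionRing.to_map_eq_zero_iff]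
    exact nonZeroDivisors.ne_zero p.2

lemma infinitesimalShiftField_algebraMap (i : Fin 2) (p : PlaneRing) :
    infinitesimalShiftField i (algebraMap PlaneRing PlaneField p) = infinitesimalShift i p :=
  IsLocalization.lift_eq _ _

lemma fst_infinitesimalShiftField (i : Fin 2) (f : PlaneField) :
    (infinitesimalShiftField i f).fst = f := by
  have : ((TrivSqZeroExt.fstHom ℚ PlaneField PlaneField).comp
      (infinitesimalShiftField i)).toRingHom = RingHom.id _ := by
    refine IsLocalization.ringHom_ext (nonZeroDivisors PlaneRing) (RingHom.ext fun p ↦ ?_)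
    change (infinitesimalShiftField i (algebraMap PlaneRing PlaneField p)).fst = _
    rw [infinitesimalShiftField_algebraMap, fst_infinitesimalShift]
    rfl
  exact RingHom.congr_fun this f

/-- The partial derivative with respect to the `i`-th coordinate on the function field. -/
noncomputable def partialDeriv (i : Fin 2) : Derivation ℚ PlaneField PlaneField :=
  Derivation.mk' ((TrivSqZeroExt.sndHom PlaneField PlaneField).restrictScalars ℚ ∘ₗ
      (infinitesimalShiftField i).toLinearMap) fun f g ↦ by
    change (infinitesimalShiftField i (f * g)).snd = f • (infinitesimalShiftField i g).snd +
      g • (infinitesimalShiftField i f).snd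
    rw [map_mul, TrivSqZeroExt.snd_mul, fst_infinitesimalShiftField, fst_infinitesimalShiftField]
    simp [mul_comm]

lemma partialDeriv_coordFn (i j : Fin 2) :
    partialDeriv i (coordFn j) = if j = i then 1 else 0 := by
  change (infinitesimalShiftField i (coordFn j)).snd = _
  rw [coordFn, infinitesimalShiftField_algebraMap, infinitesimalShift, MvPolynomial.aeval_X]
  split_ifs <;> simp

/-- The vector fields `∂`, `x ∂`, `x² ∂` in either coordinate `x` are regular. -/
lemma isRegularDerivation_pow_smul_partialDeriv (i : Fin 2) {k : ℕ} (hk : k ≤ 2) :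
    IsRegularDerivation (coordFn i ^ k • partialDeriv i) := by
  refine isRegularDerivation_of_forall_X _ fun e j ↦ ?_
  have hx := coordFn_ne_zero i
  rw [Derivation.smul_apply]
  by_cases hj : j = i
  · subst hj
    have hgen : coordFn j ^ chartSign (e j) ∈ (chartHom e).range := ⟨.X j, chartHom_X e j⟩
    by_cases he : e j = 0
    · simp only [he, chartSign, if_true, zpow_one] at hgen ⊢
      rw [partialDeriv_coordFn, if_pos rfl, smul_eq_mul, mul_one]
      exact pow_mem hgen k
    · simp only [he, chartSign, if_false, zpow_neg, zpow_one] at hgen ⊢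
      rw [Derivation.leibniz_inv, partialDeriv_coordFn, if_pos rfl]
      have : coordFn j ^ k • (-(coordFn j)⁻¹ ^ 2 • (1 : PlaneField)) =
          - (coordFn j)⁻¹ ^ (2 - k) := by
        obtain ⟨l, hl⟩ := Nat.exists_eq_add_of_le hk
        rw [hl, Nat.add_sub_cancel_left]
        simp only [smul_eq_mul]
        rw [mul_one, mul_neg, pow_add, ← mul_assoc, ← mul_pow, mul_inv_cancel₀ hx, one_pow, one_mul]
      rw [this]
      exact neg_mem (pow_mem hgen _)
  · have : partialDeriv i (coordFn j ^ chartSign (e j)) = 0 := by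
      unfold chartSign
      split_ifs
      · rw [zpow_one, partialDeriv_coordFn, if_neg hj]
      · rw [zpow_neg, zpow_one, Derivation.leibniz_inv, partialDeriv_coordFn, if_neg hj, smul_zero]
    rw [this, smul_zero]
    exact zero_mem _

lemma derivation_eq_zero_of_coordFn (D : Derivation ℚ PlaneField PlaneField)
    (h : ∀ i, D (coordFn i) = 0) : D = 0 := by
  have h1 : ∀ p : PlaneRing, D (algebraMap PlaneRing PlaneField p) = 0 := by
    intro p
    induction p using MvPolynomial.induction_on with
    | C a =>
      rw [← MvPolynomial.algebraMap_eq, ← IsScalarTower.algebraMap_apply, Derivation.map_algebraMap]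
    | add p q hp hq => rw [map_add, map_add, hp, hq, add_zero]
    | mul_X p j hp =>
      rw [map_mul, Derivation.leibniz, hp]
      change _ • D (coordFn j) + _ = _
      rw [h j]; simp
  ext f
  obtain ⟨p, q, hq, rfl⟩ := IsFractionRing.div_surjective (A := PlaneRing) f
  rw [Derivation.leibniz_div, h1, h1]
  simp

/-! ### Automorphisms of the function field respecting regular vector fields -/

/-- The transport of a derivation along an automorphism of the field. -/
noncomputable def conjDerivation (g : PlaneField ≃ₐ[ℚ] PlaneField)
    (D : Derivation ℚ PlaneField PlaneField) : Derivation ℚ PlaneField PlaneField :=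
  Derivation.mk' (g.toLinearMap ∘ₗ D.toLinearMap ∘ₗ g.symm.toLinearMap) fun a b ↦ by
    simp [Derivation.leibniz]

lemma conjDerivation_apply (g : PlaneField ≃ₐ[ℚ] PlaneField)
    (D : Derivation ℚ PlaneField PlaneField) (f : PlaneField) :
    conjDerivation g D f = g (D (g.symm f)) := rfl

/-- If `A`, `φ A` and `φ² A` are all quadratic polynomials in `x` and `A ≠ 0`, then `φ` is a
quotient of linear polynomials in `x`: in lowest terms `φ = n / m` the denominator satisfies
`m² ∣ A` and the numerator satisfies `n² ∣ φ² A`. -/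
lemma exists_moebius_of_quadratic {K : Type*} [Field K] [Algebra ℚ K] {x φ A : K}
    (hx : Transcendental ℚ x) (hφ : ∀ q : ℚ, φ ≠ algebraMap ℚ K q) (hA : A ≠ 0)
    (h : ∀ k ≤ 2, ∃ a b c : ℚ, φ ^ k * A = a • x ^ 2 + b • x + algebraMap ℚ K c) :
    ∃ M : Matrix (Fin 2) (Fin 2) ℚ, M.det ≠ 0 ∧ IsMoebiusImage M x φ := by
  have : CharZero K := charZero_of_injective_algebraMap (algebraMap ℚ K).injective
  have hinj : Function.Injective (Polynomial.aeval (R := ℚ) x) :=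
    transcendental_iff_injective.mp hx
  have h' : ∀ k ≤ 2, ∃ p : Polynomial ℚ, p.natDegree ≤ 2 ∧ Polynomial.aeval x p = φ ^ k * A := by
    intro k hk
    obtain ⟨a, b, c, e⟩ := h k hk
    refine ⟨Polynomial.C a * Polynomial.X ^ 2 + Polynomial.C b * Polynomial.X + Polynomial.C c,
      Polynomial.natDegree_quadratic_le, ?_⟩
    rw [e, Algebra.smul_def, Algebra.smul_def]
    simp only [map_add, map_mul, map_pow, Polynomial.aeval_C, Polynomial.aeval_X]
  obtain ⟨p, hp, ep⟩ := h' 0 (by norm_num)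
  obtain ⟨q, hq, eq⟩ := h' 1 (by norm_num)
  obtain ⟨r, hr, er⟩ := h' 2 (by norm_num)
  rw [pow_zero, one_mul] at ep
  rw [pow_one] at eq
  have hp0 : p ≠ 0 := by rintro rfl; exact hA (by rw [← ep, map_zero])
  have hpr : p * r = q ^ 2 := hinj (by rw [map_mul, map_pow, ep, eq, er]; ring)
  obtain ⟨g, m, n, hg, hco, rfl, rfl⟩ : ∃ g m n : Polynomial ℚ, g ≠ 0 ∧ IsCoprime m n ∧
      p = g * m ∧ q = g * n := by
    classical
    obtain ⟨m, hm⟩ := EuclideanDomain.gcd_dvd_left p q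
    obtain ⟨n, hn⟩ := EuclideanDomain.gcd_dvd_right p q
    have hg : EuclideanDomain.gcd p q ≠ 0 := fun h0 ↦ hp0 (EuclideanDomain.gcd_eq_zero_iff.mp h0).1
    refine ⟨_, m, n, hg, ?_, hm, hn⟩
    obtain ⟨a, b, hab⟩ : ∃ a b, EuclideanDomain.gcd p q = p * a + q * b :=
      ⟨_, _, EuclideanDomain.gcd_eq_gcd_ab p q⟩
    refine ⟨a, b, mul_left_cancel₀ hg ?_⟩
    linear_combination -hab - a * hm - b * hn
  have hm0 : m ≠ 0 := right_ne_zero_of_mul hp0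
  have hmr : m * r = g * n ^ 2 := mul_left_cancel₀ hg (by linear_combination hpr)
  obtain ⟨l, rfl⟩ : m ∣ g := (hco.pow_right (n := 2)).dvd_of_dvd_mul_right ⟨r, hmr.symm⟩
  have hl0 : l ≠ 0 := right_ne_zero_of_mul hg
  have hr' : r = l * n ^ 2 := mul_left_cancel₀ hm0 (by linear_combination hmr)
  have hmdeg : m.natDegree ≤ 1 := by
    have := Polynomial.natDegree_mul (mul_ne_zero hm0 hl0) hm0
    rw [Polynomial.natDegree_mul hm0 hl0] at this
    omega
  have hndeg : n.natDegree ≤ 1 := by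
    by_cases hn0 : n = 0
    · simp [hn0]
    · have := Polynomial.natDegree_mul hl0 (pow_ne_zero 2 hn0)
      rw [← hr', Polynomial.natDegree_pow] at this
      omega
  have hrel : φ * Polynomial.aeval x m = Polynomial.aeval x n := by
    have hgx : Polynomial.aeval x (m * l) ≠ 0 := fun h0 ↦ hg (hinj (by rw [h0, map_zero]))
    refine mul_left_cancel₀ hgx ?_
    rw [← map_mul _ (m * l) n, eq, ← ep, map_mul _ (m * l) m]
    ring
  have hlin : ∀ f : Polynomial ℚ, f.natDegree ≤ 1 →
      Polynomial.aeval x f = (f.coeff 1 : K) * x + (f.coeff 0 : K) := by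
    intro f hf
    conv_lhs => rw [Polynomial.eq_X_add_C_of_natDegree_le_one hf]
    simp
  rw [hlin m hmdeg, hlin n hndeg] at hrel
  refine ⟨!![n.coeff 1, n.coeff 0; m.coeff 1, m.coeff 0], fun hdet ↦ ?_, ?_⟩
  · rw [Matrix.det_fin_two_of] at hdet
    have hmx : (m.coeff 1 : K) * x + (m.coeff 0 : K) ≠ 0 := by
      rw [← hlin m hmdeg]
      exact fun h0 ↦ hm0 (hinj (by rw [h0, map_zero]))
    have hdet' : (n.coeff 1 * m.coeff 0 : K) = n.coeff 0 * m.coeff 1 := by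
      exact_mod_cast sub_eq_zero.mp hdet
    by_cases h1 : m.coeff 1 = 0
    · have h0 : m.coeff 0 ≠ 0 := by
        intro h0; apply hmx; rw [h0, h1]; simp
      have h0' : (m.coeff 0 : K) ≠ 0 := by exact_mod_cast h0
      apply hφ (n.coeff 0 / m.coeff 0)
      refine mul_right_cancel₀ hmx (hrel.trans ?_)
      rw [h1, Rat.cast_zero, mul_zero] at hdet'
      simp [h1, (mul_eq_zero.mp hdet').resolve_right h0', h0']
    · have h1' : (m.coeff 1 : K) ≠ 0 := by exact_mod_cast h1
      apply hφ (n.coeff 1 / m.coeff 1)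
      refine mul_right_cancel₀ hmx (hrel.trans ?_)
      simp only [eq_ratCast, Rat.cast_div]
      field_simp
      linear_combination -hdet'
  · simpa [IsMoebiusImage] using hrel

lemma transcendental_coordFn (i : Fin 2) : Transcendental ℚ (coordFn i) := by
  rw [transcendental_iff_injective]
  have h : LinearIndependent ℚ fun k : ℕ ↦ coordFn i ^ k := by
    have := linearIndependent_laurentMonomial.comp (fun k : ℕ ↦ Pi.single i (k : ℤ))
      fun a b hab ↦ by simpa using congrFun hab i
    convert this using 1
    funext k
    simp [laurentMonomial_single]
  rw [injective_iff_map_eq_zero]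
  intro p hp
  rw [Polynomial.aeval_eq_sum_range] at hp
  ext k
  by_cases hk : k ∈ Finset.range (p.natDegree + 1)
  · exact linearIndependent_iff'.mp h _ _ hp k hk
  · exact Polynomial.coeff_eq_zero_of_natDegree_lt (by simpa using hk)

lemma isQuadFree_of_transcendental {K : Type*} [Field K] [Algebra ℚ K] {x : K}
    (hx : Transcendental ℚ x) : IsQuadFree x := by
  intro a b c h
  have hinj := transcendental_iff_injective.mp hx
  have : Polynomial.C a * Polynomial.X ^ 2 + Polynomial.C b * Polynomial.X + Polynomial.C c = 0 :=
    hinj (by simpa using h)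
  have h0 := congrArg (Polynomial.coeff · 0) this
  have h1 := congrArg (Polynomial.coeff · 1) this
  have h2 := congrArg (Polynomial.coeff · 2) this
  simp [Polynomial.coeff_X, Polynomial.coeff_C] at h0 h1 h2
  exact ⟨h2, h1, h0⟩

lemma transcendental_algEquiv {K : Type*} [Field K] [Algebra ℚ K] {x : K}
    (hx : Transcendental ℚ x) (g : K ≃ₐ[ℚ] K) (q : ℚ) : g x ≠ algebraMap ℚ K q := by
  intro h
  refine hx ?_
  rw [← g.symm_apply_apply x, h, AlgEquiv.commutes]
  exact isAlgebraic_algebraMap q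

/-- An automorphism of the function field respecting regular vector fields sends each coordinate
function to a fractional linear transform of one of the two coordinate functions. -/
lemma exists_isMoebiusImage (g : PlaneField ≃ₐ[ℚ] PlaneField)
    (hg : ∀ D, IsRegularDerivation D → IsRegularDerivation (conjDerivation g D)) (i : Fin 2) :
    ∃ j, ∃ M : Matrix (Fin 2) (Fin 2) ℚ, M.det ≠ 0 ∧
      IsMoebiusImage M (coordFn j) (g (coordFn i)) := by
  set φ := g (coordFn i) with hφ
  have hconj : ∀ (k : ℕ) (f : PlaneField), conjDerivation g (coordFn i ^ k • partialDeriv i) f =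
      φ ^ k * conjDerivation g (partialDeriv i) f := by
    intro k f
    simp [conjDerivation_apply, hφ]
  obtain ⟨j, hj⟩ : ∃ j, conjDerivation g (partialDeriv i) (coordFn j) ≠ 0 := by
    by_contra! h
    have h1 := congrArg (· φ) (derivation_eq_zero_of_coordFn _ h)
    simp [conjDerivation_apply, hφ, partialDeriv_coordFn] at h1
  refine ⟨j, exists_moebius_of_quadratic (transcendental_coordFn j)
    (transcendental_algEquiv (transcendental_coordFn i) g) hj fun k hk ↦ ?_⟩
  have := (hg _ (isRegularDerivation_pow_smul_partialDeriv i hk)).apply_coordFn_mem j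
  rwa [hconj] at this

/-- The subfield `ℚ(x)`, where `x` is the `i`-th coordinate function. -/
noncomputable def coordSubfield (i : Fin 2) : IntermediateField ℚ PlaneField :=
  IntermediateField.adjoin ℚ {coordFn i}

lemma IsMoebiusImage.adjoin_eq {K : Type*} [Field K] [Algebra ℚ K] {x y : K}
    {M : Matrix (Fin 2) (Fin 2) ℚ} (hx : IsQuadFree x) (hM : M.det ≠ 0)
    (h : IsMoebiusImage M x y) :
    IntermediateField.adjoin ℚ {y} = IntermediateField.adjoin ℚ {x} := by
  have : CharZero K := charZero_of_injective_algebraMap (algebraMap ℚ K).injective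
  have hd := hx.den_ne_zero hM
  unfold IsMoebiusImage at h
  have hd2 : (M 1 0 : K) * y - M 0 0 ≠ 0 := by
    intro h0
    have h1 : ((M 0 0 * M 1 1 - M 0 1 * M 1 0 : ℚ) : K) = 0 := by
      push_cast
      linear_combination (M 1 0 : K) * h - ((M 1 0 : K) * x + M 1 1) * h0
    rw [Matrix.det_fin_two] at hM
    exact hM (by exact_mod_cast h1)
  have hrat : ∀ (E : IntermediateField ℚ K) (q : ℚ), (q : K) ∈ E := fun E q ↦ by
    rw [← eq_ratCast (algebraMap ℚ K)]; exact E.algebraMap_mem q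
  have hxm : x ∈ IntermediateField.adjoin ℚ {x} := IntermediateField.mem_adjoin_simple_self ℚ x
  have hym : y ∈ IntermediateField.adjoin ℚ {y} := IntermediateField.mem_adjoin_simple_self ℚ y
  apply le_antisymm
  · rw [IntermediateField.adjoin_simple_le_iff, eq_div_of_mul_eq hd h]
    exact div_mem (add_mem (mul_mem (hrat _ _) hxm) (hrat _ _))
      (add_mem (mul_mem (hrat _ _) hxm) (hrat _ _))
  · have : x = (M 0 1 - M 1 1 * y) / (M 1 0 * y - M 0 0) := by
      rw [eq_div_iff hd2]; linear_combination h
    rw [IntermediateField.adjoin_simple_le_iff, this]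
    exact div_mem (sub_mem (hrat _ _) (mul_mem (hrat _ _) hym))
      (sub_mem (mul_mem (hrat _ _) hym) (hrat _ _))

lemma coordSubfield_injective : Function.Injective coordSubfield := by
  intro i j hij
  by_contra hne
  -- the partial derivative in the direction `j` vanishes on `ℚ(x_i)` but not on `x_j`
  have h : ∀ f ∈ coordSubfield i, partialDeriv j f = 0 := by
    intro f hf
    induction hf using IntermediateField.adjoin_induction with
    | mem x hx =>
      rw [Set.mem_singleton_iff.mp hx, partialDeriv_coordFn, if_neg hne]
    | algebraMap x => exact Derivation.map_algebraMap _ _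
    | add x y _ _ hx hy => rw [map_add, hx, hy, add_zero]
    | inv x _ hx => rw [Derivation.leibniz_inv, hx, smul_zero]
    | mul x y _ _ hx hy => rw [Derivation.leibniz, hx, hy, smul_zero, smul_zero, add_zero]
  have h1 := h (coordFn j) (hij ▸ IntermediateField.mem_adjoin_simple_self ℚ _)
  rw [partialDeriv_coordFn, if_pos rfl] at h1
  exact one_ne_zero h1

lemma map_coordSubfield (g : PlaneField ≃ₐ[ℚ] PlaneField) (i : Fin 2) :
    (coordSubfield i).map (g : PlaneField →ₐ[ℚ] PlaneField) =
      IntermediateField.adjoin ℚ {g (coordFn i)} := by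
  rw [coordSubfield, IntermediateField.adjoin_map, Set.image_singleton]; rfl

lemma algEquiv_eq_one_of_coordFn (g : PlaneField ≃ₐ[ℚ] PlaneField)
    (h : ∀ i, g (coordFn i) = coordFn i) : g = 1 := by
  ext f
  have h1 : ∀ p : PlaneRing, g (algebraMap PlaneRing PlaneField p) =
      algebraMap PlaneRing PlaneField p := by
    intro p
    induction p using MvPolynomial.induction_on with
    | C a =>
      rw [← MvPolynomial.algebraMap_eq, ← IsScalarTower.algebraMap_apply, AlgEquiv.commutes]
    | add p q hp hq => rw [map_add, map_add, hp, hq]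
    | mul_X p j hp => rw [map_mul, map_mul, hp]; exact congrArg _ (h j)
  obtain ⟨p, q, hq, rfl⟩ := IsFractionRing.div_surjective (A := PlaneRing) f
  rw [map_div₀, h1, h1]; rfl

/-- A finite group of automorphisms of `ℚ(s, t)` respecting the regular vector fields of
`ℙ¹ × ℙ¹` permutes the two subfields `ℚ(s)` and `ℚ(t)`, and an element preserving both is given by
two fractional linear transformations, so the group has order at most `2 * 12 * 12`. -/
theorem card_le_of_preserves_regularDerivations (G : Subgroup (PlaneField ≃ₐ[ℚ] PlaneField))
    [Finite G] (hG : ∀ g ∈ G, ∀ D, IsRegularDerivation D →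
      IsRegularDerivation (conjDerivation g D)) : Nat.card G ≤ 288 := by
  classical
  have hperm : ∀ g : G, ∀ i, ∃ j, (coordSubfield i).map (g.1 : PlaneField →ₐ[ℚ] PlaneField) =
      coordSubfield j := by
    intro g i
    obtain ⟨j, M, hM, h⟩ := exists_isMoebiusImage g.1 (hG g.1 g.2) i
    refine ⟨j, ?_⟩
    rw [map_coordSubfield, IsMoebiusImage.adjoin_eq
      (isQuadFree_of_transcendental (transcendental_coordFn j)) hM h, coordSubfield]
  choose π hπ using hperm
  have hπmul : ∀ g h i, π (g * h) i = π g (π h i) := by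
    intro g h i
    apply coordSubfield_injective
    rw [← hπ, ← hπ, ← hπ, IntermediateField.map_map]
    rfl
  have hπone : ∀ i, π 1 i = i := by
    intro i
    apply coordSubfield_injective
    rw [← hπ]
    exact IntermediateField.map_id _
  let act : G →* Equiv.Perm (Fin 2) :=
    MonoidHom.toHomPerm
      { toFun := π
        map_one' := funext hπone
        map_mul' := fun g h ↦ funext (hπmul g h) }
  have hker : act.ker.index ≤ 2 := by
    rw [Subgroup.index_ker]
    refine (Subgroup.card_le_card_group _).trans ?_
    rw [Nat.card_eq_fintype_card]; decide
  have hst : ∀ i, (MulAction.stabilizer act.ker (coordFn i)).index ≤ 12 := by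
    intro i
    have hq := isQuadFree_of_transcendental (transcendental_coordFn i)
    refine index_stabilizer_le_twelve hq fun g ↦ ?_
    obtain ⟨j, M, hM, h⟩ := exists_isMoebiusImage g.1.1 (hG g.1.1 g.1.2) i
    have hj : j = i := by
      apply coordSubfield_injective
      have h1 : π g.1 i = i := DFunLike.congr_fun (MonoidHom.mem_ker.mp g.2) i
      rw [← h1, ← hπ, map_coordSubfield, IsMoebiusImage.adjoin_eq
        (isQuadFree_of_transcendental (transcendental_coordFn j)) hM h, coordSubfield]
    subst hj
    exact ⟨M, hM, h⟩
  have hbot : MulAction.stabilizer act.ker (coordFn 0) ⊓ MulAction.stabilizer act.ker (coordFn 1) =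
      ⊥ := by
    rw [eq_bot_iff]
    rintro g ⟨h0, h1⟩
    have : g.1.1 = 1 := algEquiv_eq_one_of_coordFn _ fun i ↦ by
      fin_cases i
      · exact h0
      · exact h1
    exact Subgroup.mem_bot.mpr (Subtype.ext (Subtype.ext this))
  have hcard : Nat.card act.ker ≤ 12 * 12 := by
    rw [← Subgroup.index_bot, ← hbot]
    exact Subgroup.index_inf_le.trans (Nat.mul_le_mul (hst 0) (hst 1))
  rw [← Subgroup.card_mul_index act.ker]
  exact Nat.mul_le_mul hcard hker

/-! ### Schemes with affine charts inside a fixed function field -/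

/-- An atlas of a scheme `X` by affine charts whose coordinate rings lie in a common field `K`:
all the inclusions of coordinate rings into `K` induce the same `K`-point of `X`. -/
structure FieldAtlas (X : Scheme.{0}) (K : Type) [Field K] where
  /-- The index set of the charts. -/
  ι : Type
  /-- The coordinate ring of a chart. -/
  ring : ι → CommRingCat.{0}
  /-- The embedding of the coordinate ring of a chart into the function field. -/
  emb : ∀ i, ring i ⟶ CommRingCat.of K
  /-- The open immersion of a chart. -/
  chart : ∀ i, Spec (ring i) ⟶ X
  /-- The generic point. -/
  pt : Spec (CommRingCat.of K) ⟶ X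
  isOpenImmersion : ∀ i, IsOpenImmersion (chart i)
  emb_injective : ∀ i, Function.Injective (emb i).hom
  map_emb_chart : ∀ i, Spec.map (emb i) ≫ chart i = pt
  exists_chart : ∀ x : X, ∃ i, x ∈ Set.range (chart i)

section LocalComparison

variable {X : Scheme.{0}} {K : Type} [Field K] {pt : Spec (CommRingCat.of K) ⟶ X}

/-- Two affine charts around the same point have the same local ring inside the function field:
an element `b` of one coordinate ring is a fraction `a / s` with `s` not vanishing at the point, and
`a` does not vanish there either if `b` does not. -/
lemma exists_fraction_of_common_point {A B : CommRingCat.{0}}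
    (ε : A ⟶ CommRingCat.of K) (δ : B ⟶ CommRingCat.of K) (c : Spec A ⟶ X) (d : Spec B ⟶ X)
    [IsOpenImmersion c] [IsOpenImmersion d] (hε : Function.Injective ε.hom)
    (hc : Spec.map ε ≫ c = pt) (hd : Spec.map δ ≫ d = pt)
    (p : PrimeSpectrum A) (q : PrimeSpectrum B) (hpq : c p = d q) (b : B) :
    ∃ a s : A, s ∉ p.asIdeal ∧ δ.hom b * ε.hom s = ε.hom a ∧ (b ∉ q.asIdeal → a ∉ p.asIdeal) := by
  -- choose a basic open neighbourhood of `p` that `c` maps into the range of `d`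
  obtain ⟨_, ⟨s, rfl⟩, hps, hs⟩ :=
    PrimeSpectrum.isTopologicalBasis_basic_opens.exists_subset_of_mem_open
    (show p ∈ c ⁻¹' Set.range d from ⟨q, hpq.symm⟩)
    (d.isOpenEmbedding.isOpen_range.preimage c.continuous)
  let As := CommRingCat.of (Localization.Away s)
  let j : A ⟶ As := CommRingCat.ofHom (algebraMap A (Localization.Away s))
  have hrange : Set.range (Spec.map j) = (PrimeSpectrum.basicOpen s : Set (PrimeSpectrum A)) :=
    PrimeSpectrum.localization_away_comap_range (Localization.Away s) s
  let g : Spec As ⟶ Spec B := IsOpenImmersion.lift d (Spec.map j ≫ c) (by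
    rintro _ ⟨y, rfl⟩
    rw [Scheme.Hom.comp_apply]
    exact hs (hrange.subset ⟨y, rfl⟩))
  have hg : g ≫ d = Spec.map j ≫ c := IsOpenImmersion.lift_fac _ _ _
  obtain ⟨θ, hθ⟩ : ∃ θ : B ⟶ As, Spec.map θ = g := ⟨Spec.preimage g, Spec.map_preimage g⟩
  have hs0 : s ≠ 0 := by
    rintro rfl
    exact hps (zero_mem _)
  have hu : IsUnit (ε.hom s) := by
    rw [isUnit_iff_ne_zero, Ne, map_eq_zero_iff _ hε]; exact hs0
  let ε' : As ⟶ CommRingCat.of K :=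
    CommRingCat.ofHom (IsLocalization.Away.lift (S := Localization.Away s) s (g := ε.hom) hu)
  have hjε : j ≫ ε' = ε := by
    ext x
    exact IsLocalization.Away.lift_eq _ hu x
  have hθε : θ ≫ ε' = δ := by
    apply Spec.map_injective
    rw [← cancel_mono d, Spec.map_comp, Category.assoc, hθ, hg, ← Category.assoc, ← Spec.map_comp,
      hjε, hc, hd]
  obtain ⟨⟨a, ⟨_, n, rfl⟩⟩, ha⟩ := IsLocalization.surj (Submonoid.powers s) (θ.hom b)
  have hspow : s ^ n ∉ p.asIdeal := fun h ↦ hps (p.2.mem_of_pow_mem n h)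
  refine ⟨a, s ^ n, hspow, ?_, fun hb hap ↦ ?_⟩
  · have := congrArg ε'.hom ha
    have h1 : ∀ x, ε'.hom (algebraMap A (Localization.Away s) x) = ε.hom x := fun x ↦
      IsLocalization.Away.lift_eq _ hu x
    rw [map_mul, h1, h1] at this
    rw [← this, ← hθε]
    rfl
  · -- the point over `p` in the localization is mapped to `q`, since `d` is injective
    obtain ⟨p', hp'⟩ : p ∈ Set.range (Spec.map j) := hrange.superset hps
    have hgq : g p' = q := by
      apply d.isOpenEmbedding.injective
      rw [← Scheme.Hom.comp_apply, hg, Scheme.Hom.comp_apply, hp', hpq]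
    have h1 : ∀ x, j.hom x ∈ p'.asIdeal ↔ x ∈ p.asIdeal := fun x ↦ by rw [← hp']; rfl
    have h2 : θ.hom b ∉ p'.asIdeal := fun h ↦ hb (by rw [← hgq, ← hθ]; exact h)
    have h3 : θ.hom b * j.hom (s ^ n) ∈ p'.asIdeal := by
      have : θ.hom b * j.hom (s ^ n) = j.hom a := ha
      rw [this]; exact (h1 a).mpr hap
    rcases p'.2.mem_or_mem h3 with h | h
    · exact h2 h
    · exact hspow ((h1 _).mp h)

end LocalComparison

namespace FieldAtlas

variable {X : Scheme.{0}} {K : Type} [Field K] (𝒰 : FieldAtlas X K)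

attribute [instance] FieldAtlas.isOpenImmersion

lemma isDomain_ring (i : 𝒰.ι) : IsDomain (𝒰.ring i) :=
  Function.Injective.isDomain (𝒰.emb i).hom (𝒰.emb_injective i)

/-- A derivation of the function field that preserves the coordinate rings of an atlas preserves
the coordinate ring of any other affine chart, since this is a condition on local rings. -/
theorem derivation_mem_range [Algebra ℚ K] (D : Derivation ℚ K K)
    (hD : ∀ i, ∀ f ∈ (𝒰.emb i).hom.range, D f ∈ (𝒰.emb i).hom.range) {B : CommRingCat.{0}}
    (δ : B ⟶ CommRingCat.of K) (d : Spec B ⟶ X) [IsOpenImmersion d]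
    (hδ : Function.Injective δ.hom) (hd : Spec.map δ ≫ d = 𝒰.pt) (f : K) (hf : f ∈ δ.hom.range) :
    D f ∈ δ.hom.range := by
  obtain ⟨b, rfl⟩ := hf
  -- the ideal of denominators of `D b`
  let J : Ideal B :=
    { carrier := {x | δ.hom x * D (δ.hom b) ∈ δ.hom.range}
      add_mem' := fun {x y} hx hy ↦ by
        simp only [Set.mem_ofPred_eq] at hx hy ⊢
        rw [map_add, add_mul]; exact add_mem hx hy
      zero_mem' := by
        simp only [Set.mem_ofPred_eq]
        rw [map_zero, zero_mul]; exact zero_mem _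
      smul_mem' := fun x y hy ↦ by
        simp only [Set.mem_ofPred_eq] at hy ⊢
        rw [smul_eq_mul, map_mul, mul_assoc]; exact mul_mem ⟨x, rfl⟩ hy }
  have hJmem : ∀ x, x ∈ J ↔ δ.hom x * D (δ.hom b) ∈ δ.hom.range := fun x ↦ Iff.rfl
  suffices hJ : J = ⊤ by
    have h1 := (hJmem 1).mp (hJ ▸ Submodule.mem_top)
    rwa [map_one, one_mul] at h1
  by_contra hJ
  obtain ⟨m, hm, hJm⟩ := Ideal.exists_le_maximal J hJ
  let q : PrimeSpectrum B := ⟨m, hm.isPrime⟩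
  obtain ⟨i, p, hp⟩ := 𝒰.exists_chart (d q)
  obtain ⟨a, s, hs, hbs, -⟩ := exists_fraction_of_common_point (𝒰.emb i) δ (𝒰.chart i) d
    (𝒰.emb_injective i) (𝒰.map_emb_chart i) hd p q hp b
  obtain ⟨a₁, ha₁⟩ := hD i _ ⟨a, rfl⟩
  obtain ⟨s₁, hs₁⟩ := hD i _ ⟨s, rfl⟩
  -- by the quotient rule, `s² D (a / s)` lies in the coordinate ring of the chart
  have hquot : (𝒰.emb i).hom s ^ 2 * D (δ.hom b) =
      (𝒰.emb i).hom (s * a₁ - a * s₁) := by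
    have h1 := congrArg D hbs
    rw [Derivation.leibniz, ← ha₁, ← hs₁, smul_eq_mul, smul_eq_mul] at h1
    rw [map_sub, map_mul, map_mul, ← h1, ← hbs]
    ring
  obtain ⟨b₁, u₁, hu₁, hbu₁, -⟩ := exists_fraction_of_common_point δ (𝒰.emb i) d (𝒰.chart i)
    hδ hd (𝒰.map_emb_chart i) q p hp.symm (s * a₁ - a * s₁)
  obtain ⟨b₂, u₂, -, hbu₂, hb₂⟩ := exists_fraction_of_common_point δ (𝒰.emb i) d (𝒰.chart i)
    hδ hd (𝒰.map_emb_chart i) q p hp.symm s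
  have hmem : u₁ * b₂ ^ 2 ∈ J := by
    rw [hJmem]
    refine ⟨b₁ * u₂ ^ 2, ?_⟩
    rw [map_mul, map_mul, map_pow, map_pow, ← hbu₁, ← hbu₂, ← hquot]
    ring
  rcases hm.isPrime.mem_or_mem (hJm hmem) with h | h
  · exact hu₁ h
  · exact hb₂ hs (hm.isPrime.mem_of_pow_mem 2 h)

lemma denseRange_map_emb (i : 𝒰.ι) : DenseRange (Spec.map (𝒰.emb i)) := by
  have : Function.Injective (𝒰.emb i).hom := 𝒰.emb_injective i
  exact (PrimeSpectrum.denseRange_comap_iff_ker_le_nilRadical _).mpr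
    (by rw [(RingHom.injective_iff_ker_eq_bot _).mp this]; exact bot_le)

lemma denseRange_pt : DenseRange 𝒰.pt := by
  intro x
  obtain ⟨i, p, rfl⟩ := 𝒰.exists_chart x
  have h1 := image_closure_subset_closure_image (𝒰.chart i).continuous
    (Set.mem_image_of_mem _ (𝒰.denseRange_map_emb i p))
  refine closure_mono ?_ h1
  rintro _ ⟨_, ⟨y, rfl⟩, rfl⟩
  exact ⟨y, by rw [← 𝒰.map_emb_chart i, Scheme.Hom.comp_apply]⟩

/-- Morphisms into a separated scheme that agree at the generic point are equal. -/
lemma hom_ext {Y : Scheme.{0}} [Y.IsSeparated] {f g : X ⟶ Y} (h : 𝒰.pt ≫ f = 𝒰.pt ≫ g) :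
    f = g := by
  let cov : X.OpenCover :=
    { I₀ := 𝒰.ι
      X := fun i ↦ Spec (𝒰.ring i)
      f := 𝒰.chart
      mem₀ := by
        rw [Scheme.presieve₀_mem_precoverage_iff]
        exact ⟨fun x ↦ 𝒰.exists_chart x, inferInstance⟩ }
  refine Scheme.Cover.hom_ext cov _ _ fun i ↦ ?_
  have := 𝒰.isDomain_ring i
  have : IsDominant (Spec.map (𝒰.emb i)) := ⟨𝒰.denseRange_map_emb i⟩
  refine ext_of_isDominant (X := Spec (𝒰.ring i)) (Spec.map (𝒰.emb i)) ?_
  change Spec.map (𝒰.emb i) ≫ 𝒰.chart i ≫ f = Spec.map (𝒰.emb i) ≫ 𝒰.chart i ≫ g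
  rw [← Category.assoc, ← Category.assoc, 𝒰.map_emb_chart, h]

/-! ### The action of automorphisms on the function field -/

/-- The function field is the fraction field of the `i`-th coordinate ring. -/
def IsFractionChart (i : 𝒰.ι) : Prop :=
  ∀ f : K, ∃ a b : 𝒰.ring i, b ≠ 0 ∧ f * (𝒰.emb i).hom b = (𝒰.emb i).hom a

lemma IsFractionChart.ringHom_ext {𝒰 : FieldAtlas X K} {i : 𝒰.ι} (hi : 𝒰.IsFractionChart i)
    {L : Type*} [Field L] {θ θ' : K →+* L}
    (h : ∀ a, θ ((𝒰.emb i).hom a) = θ' ((𝒰.emb i).hom a)) : θ = θ' := by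
  ext f
  obtain ⟨a, b, hb, hf⟩ := hi f
  have hb' : θ ((𝒰.emb i).hom b) ≠ 0 := by
    rw [Ne, map_eq_zero, map_eq_zero_iff _ (𝒰.emb_injective i)]; exact hb
  refine mul_right_cancel₀ hb' ?_
  rw [← map_mul, h b, ← map_mul, hf, h a]

/-- Two endomorphisms of the function field that move the generic point in the same way agree. -/
lemma ringHom_eq_of_map_comp_pt {i : 𝒰.ι} (hi : 𝒰.IsFractionChart i)
    {θ θ' : CommRingCat.of K ⟶ CommRingCat.of K}
    (h : Spec.map θ ≫ 𝒰.pt = Spec.map θ' ≫ 𝒰.pt) : θ = θ' := by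
  rw [← 𝒰.map_emb_chart i, ← Category.assoc, ← Category.assoc, cancel_mono, ← Spec.map_comp,
    ← Spec.map_comp] at h
  have h1 := Spec.map_injective h
  ext1
  exact hi.ringHom_ext fun a ↦ RingHom.congr_fun (congrArg CommRingCat.Hom.hom h1) a

/-- An automorphism of the scheme moves the generic point by an endomorphism of the function
field. -/
lemma exists_map_comp_pt {i : 𝒰.ι} (hi : 𝒰.IsFractionChart i) (σ : X ⟶ X) [IsIso σ] :
    ∃ θ : CommRingCat.of K ⟶ CommRingCat.of K, Spec.map θ ≫ 𝒰.pt = 𝒰.pt ≫ σ := by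
  have := 𝒰.isDomain_ring i
  have hdense : DenseRange (𝒰.pt ≫ σ) := by
    have h1 := (σ.homeomorph.surjective.denseRange).comp 𝒰.denseRange_pt σ.continuous
    convert h1 using 1
    ext x; simp
  -- the image of the generic point lies in every nonempty open subset
  have hopen : ∀ U : Set X, IsOpen U → U.Nonempty → ∀ y, (𝒰.pt ≫ σ) y ∈ U := by
    intro U hU hne y
    obtain ⟨z, hz⟩ := hdense.exists_mem_open hU hne
    have : Subsingleton (Spec (CommRingCat.of K)) :=
      inferInstanceAs (Subsingleton (PrimeSpectrum K))
    rwa [Subsingleton.elim y z]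
  have hne : Nonempty (Spec (CommRingCat.of K)) := inferInstanceAs (Nonempty (PrimeSpectrum K))
  let g : Spec (CommRingCat.of K) ⟶ Spec (𝒰.ring i) :=
    IsOpenImmersion.lift (𝒰.chart i) (𝒰.pt ≫ σ) (by
      rintro _ ⟨y, rfl⟩
      refine hopen _ (𝒰.chart i).isOpenEmbedding.isOpen_range ?_ y
      exact ⟨_, ⟨Spec.map (𝒰.emb i) y, rfl⟩⟩)
  have hg : g ≫ 𝒰.chart i = 𝒰.pt ≫ σ := IsOpenImmersion.lift_fac _ _ _
  obtain ⟨θ, hθ⟩ : ∃ θ : 𝒰.ring i ⟶ CommRingCat.of K, Spec.map θ = g :=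
    ⟨Spec.preimage g, Spec.map_preimage g⟩
  have hinj : ∀ a, θ.hom a = 0 → a = 0 := by
    intro a ha
    by_contra ha0
    let y : Spec (CommRingCat.of K) := hne.some
    have h1 : (𝒰.pt ≫ σ) y ∈ 𝒰.chart i '' (PrimeSpectrum.basicOpen a : Set (PrimeSpectrum _)) := by
      refine hopen _ ((𝒰.chart i).isOpenEmbedding.isOpenMap _ (PrimeSpectrum.basicOpen a).2) ?_ y
      refine ⟨_, ⟨(⟨⊥, Ideal.isPrime_bot⟩ : PrimeSpectrum (𝒰.ring i)), ?_, rfl⟩⟩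
      exact ha0
    rw [← hg, Scheme.Hom.comp_apply] at h1
    obtain ⟨z, hz, hzy⟩ := h1
    have h2 : z = g y := (𝒰.chart i).isOpenEmbedding.injective hzy
    rw [h2, ← hθ] at hz
    refine hz (show θ.hom a ∈ y.asIdeal from ?_)
    rw [ha]; exact zero_mem _
  let _ : Algebra (𝒰.ring i) K := (𝒰.emb i).hom.toAlgebra
  have hfrac : IsFractionRing (𝒰.ring i) K := by
    have : FaithfulSMul (𝒰.ring i) K :=
      (faithfulSMul_iff_algebraMap_injective _ _).mpr (𝒰.emb_injective i)
    refine IsFractionRing.of_field _ _ fun f ↦ ?_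
    obtain ⟨a, b, hb, hf⟩ := hi f
    refine ⟨a, b, ?_⟩
    rw [eq_div_iff]
    · exact hf.symm ▸ rfl
    · change (𝒰.emb i).hom b ≠ 0
      rw [Ne, map_eq_zero_iff _ (𝒰.emb_injective i)]; exact hb
  have hinj' : Function.Injective θ.hom := (injective_iff_map_eq_zero _).mpr hinj
  let θ' : CommRingCat.of K ⟶ CommRingCat.of K := CommRingCat.ofHom
    (IsFractionRing.lift (A := 𝒰.ring i) (K := K) (g := θ.hom) hinj')
  have hθ' : 𝒰.emb i ≫ θ' = θ := by
    ext a
    exact IsFractionRing.lift_algebraMap hinj' a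
  refine ⟨θ', ?_⟩
  conv_lhs => rw [← 𝒰.map_emb_chart i]
  rw [← Category.assoc, ← Spec.map_comp, hθ', hθ, hg]

/-- The automorphism group of a separated scheme over `ℚ` with an atlas acts faithfully on the
function field. -/
theorem exists_action_on_field [Algebra ℚ K] {Y : Over (Spec (CommRingCat.of ℚ))}
    [Y.left.IsSeparated] (𝒰 : FieldAtlas Y.left K) {i : 𝒰.ι} (hi : 𝒰.IsFractionChart i) :
    ∃ Φ : Aut Y →* (K ≃ₐ[ℚ] K), Function.Injective Φ ∧ ∀ σ : Aut Y,
      Spec.map (CommRingCat.ofHom ((Φ σ).symm : K →+* K)) ≫ 𝒰.pt = 𝒰.pt ≫ σ.hom.left := by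
  have hex : ∀ σ : Aut Y, ∃ θ : CommRingCat.of K ⟶ CommRingCat.of K,
      Spec.map θ ≫ 𝒰.pt = 𝒰.pt ≫ σ.hom.left := fun σ ↦
    have : IsIso σ.hom.left := ((Over.forget _).mapIso σ).isIso_hom
    𝒰.exists_map_comp_pt hi σ.hom.left
  choose θ hθ using hex
  have hone : θ 1 = 𝟙 _ := by
    apply 𝒰.ringHom_eq_of_map_comp_pt hi
    rw [hθ, Spec.map_id, Category.id_comp]
    exact Category.comp_id _
  have hmul : ∀ f g : Aut Y, θ (f * g) = θ f ≫ θ g := by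
    intro f g
    apply 𝒰.ringHom_eq_of_map_comp_pt hi
    rw [hθ, Spec.map_comp, Category.assoc, hθ f, ← Category.assoc, hθ g, Category.assoc]
    rfl
  have hinv : ∀ f : Aut Y, ∀ x, (θ f⁻¹).hom ((θ f).hom x) = x := by
    intro f x
    have := hmul f f⁻¹
    rw [mul_inv_cancel, hone] at this
    exact (RingHom.congr_fun (congrArg CommRingCat.Hom.hom this) x).symm
  let Φ : Aut Y →* (K ≃ₐ[ℚ] K) := MonoidHom.mk' (fun σ ↦ AlgEquiv.ofRingEquiv
      (f := RingEquiv.ofRingHom (θ σ⁻¹).hom (θ σ).hom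
        (RingHom.ext fun x ↦ hinv σ x) (RingHom.ext fun x ↦ by simpa using hinv σ⁻¹ x))
      fun q ↦ RingHom.map_rat_algebraMap (θ σ⁻¹).hom q) fun f g ↦ by
    ext x
    change (θ (f * g)⁻¹).hom x = (θ f⁻¹).hom ((θ g⁻¹).hom x)
    rw [mul_inv_rev, hmul]
    rfl
  refine ⟨Φ, (injective_iff_map_eq_one Φ).mpr fun σ hσ ↦ ?_, fun σ ↦ hθ σ⟩
  have h1 : θ σ = 𝟙 _ := by
    ext x
    exact AlgEquiv.congr_fun (congrArg AlgEquiv.symm hσ) x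
  have h2 := hθ σ
  rw [h1, Spec.map_id, Category.id_comp] at h2
  have h3 : σ.hom.left = 𝟙 _ := 𝒰.hom_ext (by rw [← h2, Category.comp_id])
  exact Iso.ext (Over.OverMorphism.ext h3)

/-- Automorphisms of the scheme transport global vector fields to global vector fields. -/
theorem conj_derivation_mem_range [Algebra ℚ K] (D : Derivation ℚ K K)
    (hD : ∀ i, ∀ f ∈ (𝒰.emb i).hom.range, D f ∈ (𝒰.emb i).hom.range) (σ : X ≅ X) (g : K ≃ₐ[ℚ] K)
    (hg : Spec.map (CommRingCat.ofHom (g.symm : K →+* K)) ≫ 𝒰.pt = 𝒰.pt ≫ σ.hom) (i : 𝒰.ι)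
    (f : K) (hf : f ∈ (𝒰.emb i).hom.range) : g (D (g.symm f)) ∈ (𝒰.emb i).hom.range := by
  obtain ⟨a, rfl⟩ := hf
  -- the chart `i` transported by `σ⁻¹` has coordinate ring `g⁻¹ (emb i)`
  have hδ : Spec.map (𝒰.emb i ≫ CommRingCat.ofHom (g.symm : K →+* K)) ≫ 𝒰.chart i ≫ σ.inv =
      𝒰.pt := by
    rw [Spec.map_comp, Category.assoc, reassoc_of% (𝒰.map_emb_chart i), reassoc_of% hg,
      σ.hom_inv_id, Category.comp_id]
  obtain ⟨b, hb⟩ := 𝒰.derivation_mem_range D hD _ (𝒰.chart i ≫ σ.inv)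
    (g.symm.injective.comp (𝒰.emb_injective i)) hδ (g.symm ((𝒰.emb i).hom a)) ⟨a, rfl⟩
  refine ⟨b, ?_⟩
  rw [← hb]
  exact (g.apply_symm_apply _).symm

end FieldAtlas

/-! ### Points of the projective line with given homogeneous coordinates -/

/-- Two morphisms to the spectrum of `ℚ` are equal, because a ring has at most one homomorphism
from `ℚ`. -/
lemma subsingleton_hom_spec_rat (X : Scheme.{0}) :
    Subsingleton (X ⟶ Spec (CommRingCat.of ℚ)) := by
  refine ⟨fun f g ↦ ?_⟩
  exact ext_to_Spec (CommRingCat.hom_ext (Subsingleton.elim (α := ℚ →+* _) _ _))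

lemma aeval_smul_of_isHomogeneous {R : Type*} [CommRing R] [Algebra ℚ R] (l : R) (u : Fin 2 → R)
    {n : ℕ} {x : MvPolynomial (Fin 2) ℚ} (hx : x ∈ coordGrading n) :
    MvPolynomial.aeval (fun i ↦ l * u i) x = l ^ n * MvPolynomial.aeval u x := by
  rw [MvPolynomial.aeval_def, MvPolynomial.aeval_def, MvPolynomial.eval₂_eq',
    MvPolynomial.eval₂_eq', Finset.mul_sum]
  refine Finset.sum_congr rfl fun m hm ↦ ?_
  have hdeg : ∑ i, m i = n := by
    have := (MvPolynomial.mem_homogeneousSubmodule n x).mp hx (MvPolynomial.mem_support_iff.mp hm)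
    rw [← this, Finsupp.weight_apply, Finsupp.sum_fintype _ _ (by simp)]
    simp
  simp only [mul_pow, Finset.prod_mul_distrib, Finset.prod_pow_eq_pow_sum, hdeg]
  ring

section Points

variable {R : Type} [CommRing R] [Algebra ℚ R]

/-- Evaluation of degree zero fractions `x / f ^ n` at homogeneous coordinates `u` with `f(u)`
invertible. -/
noncomputable def awayEval (u : Fin 2 → R) (f : MvPolynomial (Fin 2) ℚ)
    (h : IsUnit (MvPolynomial.aeval u f)) : HomogeneousLocalization.Away coordGrading f →+* R :=
  (IsLocalization.Away.lift (S := Localization.Away f) f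
    (g := (MvPolynomial.aeval u : MvPolynomial (Fin 2) ℚ →ₐ[ℚ] R).toRingHom) h).comp
    (algebraMap (HomogeneousLocalization.Away coordGrading f) (Localization.Away f))

lemma awayEval_mk (u : Fin 2 → R) {f : MvPolynomial (Fin 2) ℚ} {d : ℕ} (hf : f ∈ coordGrading d)
    (h : IsUnit (MvPolynomial.aeval u f)) (n : ℕ) (x : MvPolynomial (Fin 2) ℚ)
    (hx : x ∈ coordGrading (n • d)) :
    awayEval u f h (HomogeneousLocalization.Away.mk coordGrading hf n x hx) *
      MvPolynomial.aeval u f ^ n = MvPolynomial.aeval u x := by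
  have h1 : ∀ y, IsLocalization.Away.lift (S := Localization.Away f) f
      (g := (MvPolynomial.aeval u : MvPolynomial (Fin 2) ℚ →ₐ[ℚ] R).toRingHom) h
      (algebraMap _ _ y) = MvPolynomial.aeval u y := fun y ↦ IsLocalization.Away.lift_eq _ h y
  rw [awayEval, RingHom.comp_apply, HomogeneousLocalization.algebraMap_apply,
    HomogeneousLocalization.Away.val_mk, ← map_pow, ← h1, ← map_mul]
  rw [← h1 x]
  congr 1
  rw [Localization.mk_eq_mk']
  exact IsLocalization.mk'_spec (Localization.Away f) x
    (⟨f ^ n, ⟨n, rfl⟩⟩ : Submonoid.powers f)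

lemma awayEval_ext {u : Fin 2 → R} {f : MvPolynomial (Fin 2) ℚ} {d : ℕ} (hf : f ∈ coordGrading d)
    (hu : IsUnit (MvPolynomial.aeval u f))
    {φ : HomogeneousLocalization.Away coordGrading f →+* R}
    (h : ∀ n x hx, φ (HomogeneousLocalization.Away.mk coordGrading hf n x hx) *
      MvPolynomial.aeval u f ^ n = MvPolynomial.aeval u x) : φ = awayEval u f hu := by
  ext z
  obtain ⟨n, x, hx, rfl⟩ := HomogeneousLocalization.Away.mk_surjective coordGrading hf z
  exact (hu.pow n).mul_right_cancel ((h n x hx).trans (awayEval_mk u hf hu n x hx).symm)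

/-- The `R`-valued point of the projective line with homogeneous coordinates `u`, where some linear
form `f` is invertible at `u`. -/
noncomputable def pointOf (u : Fin 2 → R) (f : MvPolynomial (Fin 2) ℚ) (hf : f ∈ coordGrading 1)
    (h : IsUnit (MvPolynomial.aeval u f)) : Spec (CommRingCat.of R) ⟶ Proj coordGrading :=
  Spec.map (CommRingCat.ofHom (awayEval u f h)) ≫ Proj.awayι coordGrading f hf Nat.one_pos

/-- The point with given homogeneous coordinates does not depend on the linear form. -/
lemma pointOf_eq_pointOf (u : Fin 2 → R) {f g : MvPolynomial (Fin 2) ℚ} (hf : f ∈ coordGrading 1)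
    (hg : g ∈ coordGrading 1) (huf : IsUnit (MvPolynomial.aeval u f))
    (hug : IsUnit (MvPolynomial.aeval u g)) : pointOf u f hf huf = pointOf u g hg hug := by
  have hprod : IsUnit (MvPolynomial.aeval u (f * g)) := by rw [map_mul]; exact huf.mul hug
  have key : ∀ {f g : MvPolynomial (Fin 2) ℚ} (hf : f ∈ coordGrading 1) (hg : g ∈ coordGrading 1)
      (huf : IsUnit (MvPolynomial.aeval u f)) (hug : IsUnit (MvPolynomial.aeval u g))
      (p : MvPolynomial (Fin 2) ℚ) (hp : p = f * g) (hup : IsUnit (MvPolynomial.aeval u p))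
      (hp2 : p ∈ coordGrading 2),
      pointOf u f hf huf = Spec.map (CommRingCat.ofHom (awayEval u p hup)) ≫
        Proj.awayι coordGrading p hp2 Nat.two_pos := by
    intro f g hf hg huf hug p hp hup hp2
    have := Proj.SpecMap_awayMap_awayι coordGrading hf Nat.one_pos hg hp
    rw [← this, ← Category.assoc, ← Spec.map_comp, ← CommRingCat.ofHom_comp, pointOf]
    congr 3
    symm
    refine awayEval_ext hf huf fun n x hx ↦ ?_
    rw [RingHom.comp_apply, HomogeneousLocalization.awayMap_mk]
    have hmem : x * g ^ n ∈ coordGrading (n • 2) := by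
      have := SetLike.mul_mem_graded hx (SetLike.pow_mem_graded n hg)
      convert this using 2
      simp only [smul_eq_mul]; ring
    have h1 := awayEval_mk u hp2 hup n (x * g ^ n) hmem
    have hpe : MvPolynomial.aeval u p = MvPolynomial.aeval u f * MvPolynomial.aeval u g := by
      rw [hp, map_mul]
    refine (hug.pow n).mul_right_cancel ?_
    rw [hpe, mul_pow, ← mul_assoc, map_mul, map_pow] at h1
    exact h1
  have hp2 : f * g ∈ coordGrading 2 := SetLike.mul_mem_graded hf hg
  rw [key hf hg huf hug (f * g) rfl hprod hp2, key hg hf hug huf (f * g) (mul_comm _ _) hprod hp2]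

/-- Proportional homogeneous coordinates define the same point. -/
lemma pointOf_smul (u : Fin 2 → R) {l : R} (hl : IsUnit l) {f : MvPolynomial (Fin 2) ℚ}
    (hf : f ∈ coordGrading 1) (h : IsUnit (MvPolynomial.aeval u f))
    (h' : IsUnit (MvPolynomial.aeval (fun i ↦ l * u i) f)) :
    pointOf (fun i ↦ l * u i) f hf h' = pointOf u f hf h := by
  rw [pointOf, pointOf]
  congr 3
  refine awayEval_ext hf h fun n x hx ↦ ?_
  have h1 := awayEval_mk _ hf h' n x hx
  rw [aeval_smul_of_isHomogeneous l u hf, aeval_smul_of_isHomogeneous l u hx] at h1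
  refine (hl.pow n).mul_left_cancel ?_
  simp only [smul_eq_mul, mul_one, pow_one] at h1
  rw [← h1]; ring

/-- Points are functorial in the ring of values. -/
lemma map_comp_pointOf {S : Type} [CommRing S] [Algebra ℚ S] (φ : R →ₐ[ℚ] S) (u : Fin 2 → R)
    {f : MvPolynomial (Fin 2) ℚ} (hf : f ∈ coordGrading 1) (h : IsUnit (MvPolynomial.aeval u f))
    (h' : IsUnit (MvPolynomial.aeval (fun i ↦ φ (u i)) f)) :
    Spec.map (CommRingCat.ofHom (φ : R →+* S)) ≫ pointOf u f hf h =
      pointOf (fun i ↦ φ (u i)) f hf h' := by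
  have hφ : ∀ x, MvPolynomial.aeval (fun i ↦ φ (u i)) x = φ (MvPolynomial.aeval u x) := fun x ↦
    (MvPolynomial.comp_aeval_apply u φ x).symm
  rw [pointOf, pointOf, ← Category.assoc, ← Spec.map_comp, ← CommRingCat.ofHom_comp]
  congr 3
  refine awayEval_ext hf h' fun n x hx ↦ ?_
  rw [hφ, hφ, ← awayEval_mk u hf h n x hx, map_mul, map_pow]
  rfl

/-- A graded endomorphism of the coordinate ring acts on points by evaluating the images of the
homogeneous coordinates. -/
lemma pointOf_comp_map (u : Fin 2 → R) (γ : coordGrading →+*ᵍ coordGrading)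
    (hγ : (HomogeneousIdeal.irrelevant coordGrading) ≤
      (HomogeneousIdeal.irrelevant coordGrading).map γ)
    {f : MvPolynomial (Fin 2) ℚ} (hf : f ∈ coordGrading 1)
    (h : IsUnit (MvPolynomial.aeval u (γ f)))
    (h' : IsUnit (MvPolynomial.aeval (fun i ↦ MvPolynomial.aeval u (γ (.X i))) f)) :
    pointOf u (γ f) (γ.map_mem hf) h ≫ Proj.map γ hγ =
      pointOf (fun i ↦ MvPolynomial.aeval u (γ (.X i))) f hf h' := by
  have hγu : ∀ x, MvPolynomial.aeval (fun i ↦ MvPolynomial.aeval u (γ (.X i))) x =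
      MvPolynomial.aeval u (γ x) := by
    intro x
    have : (MvPolynomial.aeval fun i ↦ MvPolynomial.aeval u (γ (.X i)) :
        MvPolynomial (Fin 2) ℚ →ₐ[ℚ] R).toRingHom =
        (MvPolynomial.aeval u : MvPolynomial (Fin 2) ℚ →ₐ[ℚ] R).toRingHom.comp γ.toRingHom := by
      refine MvPolynomial.ringHom_ext' (Subsingleton.elim _ _) fun i ↦ ?_
      simp
    exact RingHom.congr_fun this x
  rw [pointOf, pointOf, Category.assoc, Proj.awayι_comp_map γ hγ Nat.one_pos f hf,
    ← Category.assoc, ← Spec.map_comp, ← CommRingCat.ofHom_comp]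
  congr 3
  refine awayEval_ext hf h' fun n x hx ↦ ?_
  rw [RingHom.comp_apply, HomogeneousLocalization.Away.map_mk, hγu, hγu]
  exact awayEval_mk u (γ.map_mem hf) h n (γ x) (γ.map_mem hx)

lemma X_mem_coordGrading (i : Fin 2) :
    (MvPolynomial.X i : MvPolynomial (Fin 2) ℚ) ∈ coordGrading 1 :=
  MvPolynomial.isHomogeneous_X ℚ i

/-- Points of the chart `x₀ ≠ 0` that agree have proportional coordinates. -/
lemma eq_of_pointOf_eq {u v : Fin 2 → R} (hu : IsUnit (MvPolynomial.aeval u (MvPolynomial.X 0)))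
    (hv : IsUnit (MvPolynomial.aeval v (MvPolynomial.X 0)))
    (h : pointOf u _ (X_mem_coordGrading 0) hu = pointOf v _ (X_mem_coordGrading 0) hv) :
    u 1 * v 0 = v 1 * u 0 := by
  rw [pointOf, pointOf, cancel_mono] at h
  have h1 : awayEval u _ hu = awayEval v _ hv := congrArg CommRingCat.Hom.hom (Spec.map_injective h)
  have hX : (MvPolynomial.X 1 : MvPolynomial (Fin 2) ℚ) ∈ coordGrading (1 • 1) :=
    X_mem_coordGrading 1
  have e1 := awayEval_mk u (X_mem_coordGrading 0) hu 1 _ hX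
  have e2 := awayEval_mk v (X_mem_coordGrading 0) hv 1 _ hX
  rw [h1] at e1
  simp only [MvPolynomial.aeval_X, pow_one] at e1 e2
  rw [← e1, ← e2]; ring

end Points

/-! ### The affine charts of the projective line -/

/-- The homogeneous coordinates of the point of the affine chart `x_i ≠ 0` with affine
coordinate `T`. -/
noncomputable def lineCoords (i j : Fin 2) : Polynomial ℚ := if j = i then 1 else Polynomial.X

lemma isUnit_lineCoords (i : Fin 2) :
    IsUnit (MvPolynomial.aeval (lineCoords i) (MvPolynomial.X i : MvPolynomial (Fin 2) ℚ)) := by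
  simp [lineCoords]

/-- The affine chart `x_i ≠ 0` of the projective line. -/
noncomputable def lineChart (i : Fin 2) :
    Spec (CommRingCat.of (Polynomial ℚ)) ⟶ Proj coordGrading :=
  pointOf (lineCoords i) (.X i) (X_mem_coordGrading i) (isUnit_lineCoords i)

/-- A degree zero fraction `x / x_i ^ n` is determined by dehomogenizing the numerator. -/
lemma awayEval_lineCoords_bijective (i : Fin 2) :
    Function.Bijective (awayEval (lineCoords i) _ (isUnit_lineCoords i)) := by
  have h1 : ∀ n x hx, awayEval (lineCoords i) _ (isUnit_lineCoords i)
      (HomogeneousLocalization.Away.mk coordGrading (X_mem_coordGrading i) n x hx) =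
        MvPolynomial.aeval (lineCoords i) x := by
    intro n x hx
    have := awayEval_mk (lineCoords i) (X_mem_coordGrading i) (isUnit_lineCoords i) n x hx
    simpa [lineCoords] using this
  constructor
  · rw [injective_iff_map_eq_zero]
    intro z hz
    obtain ⟨n, x, hx, rfl⟩ :=
      HomogeneousLocalization.Away.mk_surjective coordGrading (X_mem_coordGrading i) z
    rw [h1] at hz
    -- homogenize: `x = x_i ^ n * x(1, x_j / x_i)`
    apply HomogeneousLocalization.val_injective
    rw [HomogeneousLocalization.Away.val_mk, HomogeneousLocalization.val_zero]
    let L := Localization.Away (MvPolynomial.X i : MvPolynomial (Fin 2) ℚ)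
    let a : MvPolynomial (Fin 2) ℚ →ₐ[ℚ] L := IsScalarTower.toAlgHom ℚ _ L
    obtain ⟨w, hw⟩ : IsUnit (a (.X i)) := IsLocalization.Away.algebraMap_isUnit _
    have hx' : a x = 0 := by
      let ev : Polynomial ℚ →ₐ[ℚ] L := Polynomial.aeval (↑w⁻¹ * a (.X (1 - i)))
      have h2 := aeval_smul_of_isHomogeneous (w : L) (fun j ↦ ev (lineCoords i j)) hx
      have h3 : (fun j ↦ (w : L) * ev (lineCoords i j)) = fun j ↦ a (.X j) := by
        funext j
        by_cases hj : j = i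
        · subst hj; simp [lineCoords, hw]
        · have : j = 1 - i := by fin_cases i <;> fin_cases j <;> simp_all
          subst this
          simp [lineCoords, hj, ev]
      have h4 : MvPolynomial.aeval (fun j ↦ ev (lineCoords i j)) x = 0 := by
        rw [← MvPolynomial.comp_aeval_apply, hz, map_zero]
      rw [h3, h4, mul_zero, ← MvPolynomial.comp_aeval_apply,
        MvPolynomial.aeval_X_left_apply] at h2
      exact h2
    rw [Localization.mk_eq_mk']
    exact (IsLocalization.mk'_eq_zero_iff _ _).mpr
      ((IsLocalization.map_eq_zero_iff (Submonoid.powers (MvPolynomial.X i)) L x).mp hx')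
  · intro p
    induction p using Polynomial.induction_on' with
    | add p q hp hq =>
      obtain ⟨a, rfl⟩ := hp
      obtain ⟨b, rfl⟩ := hq
      exact ⟨a + b, map_add _ _ _⟩
    | monomial n c =>
      refine ⟨HomogeneousLocalization.Away.mk coordGrading (X_mem_coordGrading i) n
        (.C c * .X (1 - i) ^ n) ?_, ?_⟩
      · rw [smul_eq_mul, mul_one]
        have := (MvPolynomial.isHomogeneous_C (Fin 2) c).mul
          ((MvPolynomial.isHomogeneous_X ℚ (1 - i)).pow n)
        simpa using this
      · have hne : (1 - i : Fin 2) ≠ i := by fin_cases i <;> simp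
        rw [h1]
        simp [lineCoords, hne, Polynomial.C_mul_X_pow_eq_monomial]

instance (i : Fin 2) : IsOpenImmersion (lineChart i) := by
  have h1 : IsIso (CommRingCat.ofHom (awayEval (lineCoords i) _ (isUnit_lineCoords i))) :=
    (RingEquiv.ofBijective _ (awayEval_lineCoords_bijective i)).toCommRingCatIso.isIso_hom
  rw [lineChart, pointOf]
  infer_instance

lemma range_lineChart (i : Fin 2) :
    Set.range (lineChart i) = (Proj.basicOpen coordGrading (.X i) : Set (Proj coordGrading)) := by
  have h1 : IsIso (CommRingCat.ofHom (awayEval (lineCoords i) _ (isUnit_lineCoords i))) :=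
    (RingEquiv.ofBijective _ (awayEval_lineCoords_bijective i)).toCommRingCatIso.isIso_hom
  have h2 : (lineChart i).opensRange = Proj.basicOpen coordGrading (.X i) :=
    (Scheme.Hom.opensRange_comp_of_isIso _ _).trans (Proj.opensRange_awayι _ _ _ _)
  rw [← h2]; rfl

lemma exists_mem_range_lineChart (x : Proj coordGrading) : ∃ i, x ∈ Set.range (lineChart i) := by
  have h := Proj.iSup_basicOpen_eq_top coordGrading
    (MvPolynomial.X : Fin 2 → MvPolynomial (Fin 2) ℚ) (by
      rw [HomogeneousIdeal.irrelevant_eq_span, Ideal.span_le]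
      intro p hp
      simp only [Set.mem_iUnion] at hp
      obtain ⟨n, hn, hp⟩ := hp
      rw [SetLike.mem_coe, ← Set.image_univ, MvPolynomial.mem_ideal_span_X_image]
      intro m hm
      by_contra! hm0
      have hm1 : m = 0 := by ext i; simpa using hm0 i
      have := (MvPolynomial.mem_homogeneousSubmodule n p).mp hp
        (MvPolynomial.mem_support_iff.mp hm)
      rw [hm1, map_zero] at this
      exact hn.ne this)
  have hx : x ∈ ⨆ i, Proj.basicOpen coordGrading (MvPolynomial.X i : MvPolynomial (Fin 2) ℚ) :=
    h ▸ TopologicalSpace.Opens.mem_top x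
  obtain ⟨i, hi⟩ := TopologicalSpace.Opens.mem_iSup.mp hx
  exact ⟨i, (range_lineChart i).superset hi⟩

/-! ### The atlas of the surface -/

open scoped TensorProduct

/-- The point `[1 : x]` of the projective line. -/
noncomputable def linePoint {R : Type} [CommRing R] [Algebra ℚ R] (x : R) :
    Spec (CommRingCat.of R) ⟶ Proj coordGrading :=
  pointOf ![1, x] (.X 0) (X_mem_coordGrading 0) (by simp)

/-- The point with affine coordinate `x` in the chart `x₀ ≠ 0` has affine coordinate `x⁻¹` in the
chart `x₁ ≠ 0`. -/
lemma map_comp_lineChart {K : Type} [Field K] [Algebra ℚ K] (i : Fin 2) {x : K} (hx : x ≠ 0)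
    (φ : Polynomial ℚ →ₐ[ℚ] K) (hφ : φ .X = x ^ chartSign i) :
    Spec.map (CommRingCat.ofHom (φ : Polynomial ℚ →+* K)) ≫ lineChart i = linePoint x := by
  have h' : IsUnit (MvPolynomial.aeval (fun j ↦ φ (lineCoords i j))
      (MvPolynomial.X i : MvPolynomial (Fin 2) ℚ)) := by simp [lineCoords]
  rw [lineChart, map_comp_pointOf φ _ _ _ h']
  fin_cases i
  · have h1 : (fun j ↦ φ (lineCoords 0 j)) = ![1, x] := by
      funext j
      fin_cases j
      · simp [lineCoords]
      · simpa [lineCoords, chartSign] using hφ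
    simp only [Fin.zero_eta, h1]
    rfl
  · have h1 : (fun j ↦ φ (lineCoords 1 j)) = fun j ↦ x⁻¹ * (![1, x] : Fin 2 → K) j := by
      funext j
      fin_cases j
      · simpa [lineCoords, chartSign] using hφ
      · simp [lineCoords, hx]
    simp only [Fin.mk_one, h1]
    have h2 : IsUnit (MvPolynomial.aeval (![1, x] : Fin 2 → K)
      (MvPolynomial.X 1 : MvPolynomial (Fin 2) ℚ)) := by simp [hx]
    rw [pointOf_smul ![1, x] (inv_ne_zero hx).isUnit (X_mem_coordGrading 1) h2]
    exact pointOf_eq_pointOf _ _ _ _ _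

/-- The inclusion `ℚ[T] → ℚ[s, t]` of polynomials in the `k`-th variable. -/
noncomputable def planeIncl (k : Fin 2) : Polynomial ℚ →ₐ[ℚ] PlaneRing :=
  Polynomial.aeval (.X k)

/-- The identification `ℚ[T] ⊗ ℚ[T] = ℚ[s, t]`. -/
noncomputable def tensorEquivPlaneRing :
    TensorProduct ℚ (Polynomial ℚ) (Polynomial ℚ) ≃ₐ[ℚ] PlaneRing :=
  AlgEquiv.ofAlgHom (Algebra.TensorProduct.productMap (planeIncl 0) (planeIncl 1))
    (MvPolynomial.aeval ![Polynomial.X ⊗ₜ 1, 1 ⊗ₜ Polynomial.X])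
    (by
      ext i
      fin_cases i <;> simp [planeIncl])
    (by
      ext <;> simp [planeIncl])

/-- The structure morphism of the projective line, with its source stated as a `Proj`. -/
noncomputable def lineStr : Proj coordGrading ⟶ Spec (CommRingCat.of ℚ) := projLine.hom

/-- The standard affine chart `x_{e 0} ≠ 0`, `y_{e 1} ≠ 0` of `ℙ¹ × ℙ¹`. -/
noncomputable def planeChart (e : Fin 2 → Fin 2) :
    Spec (CommRingCat.of PlaneRing) ⟶ pullback lineStr lineStr :=
  pullback.lift (f := lineStr) (g := lineStr)
    (Spec.map (CommRingCat.ofHom (planeIncl 0 : Polynomial ℚ →+* PlaneRing)) ≫ lineChart (e 0))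
    (Spec.map (CommRingCat.ofHom (planeIncl 1 : Polynomial ℚ →+* PlaneRing)) ≫ lineChart (e 1))
    ((subsingleton_hom_spec_rat _).elim _ _)

/-- The product of two charts of the projective line. -/
noncomputable def lineChartProd (e : Fin 2 → Fin 2) :
    pullback (Spec.map (CommRingCat.ofHom (algebraMap ℚ (Polynomial ℚ))))
      (Spec.map (CommRingCat.ofHom (algebraMap ℚ (Polynomial ℚ)))) ⟶
      pullback lineStr lineStr :=
  pullback.map _ _ _ _ (lineChart (e 0)) (lineChart (e 1)) (𝟙 _)
    ((subsingleton_hom_spec_rat _).elim _ _) ((subsingleton_hom_spec_rat _).elim _ _)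

lemma planeChart_eq (e : Fin 2 → Fin 2) : planeChart e =
    Spec.map tensorEquivPlaneRing.toRingEquiv.toCommRingCatIso.hom ≫
      (pullbackSpecIso ℚ (Polynomial ℚ) (Polynomial ℚ)).inv ≫ lineChartProd e := by
  have h0 : CommRingCat.ofHom (planeIncl 0 : Polynomial ℚ →+* PlaneRing) =
      CommRingCat.ofHom Algebra.TensorProduct.includeLeftRingHom ≫
        tensorEquivPlaneRing.toRingEquiv.toCommRingCatIso.hom := by
    refine CommRingCat.hom_ext (RingHom.ext fun x ↦ ?_)
    change planeIncl 0 x = tensorEquivPlaneRing (x ⊗ₜ 1)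
    simp [tensorEquivPlaneRing]
  have h1 : CommRingCat.ofHom (planeIncl 1 : Polynomial ℚ →+* PlaneRing) =
      CommRingCat.ofHom (Algebra.TensorProduct.includeRight : Polynomial ℚ →ₐ[ℚ] _).toRingHom ≫
        tensorEquivPlaneRing.toRingEquiv.toCommRingCatIso.hom := by
    refine CommRingCat.hom_ext (RingHom.ext fun x ↦ ?_)
    change planeIncl 1 x = tensorEquivPlaneRing (1 ⊗ₜ x)
    simp [tensorEquivPlaneRing]
  apply pullback.hom_ext
  · simp only [planeChart, lineChartProd, Category.assoc, pullback.lift_fst,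
      pullbackSpecIso_inv_fst_assoc, h0, Spec.map_comp,
      Category.assoc]
  · simp only [planeChart, lineChartProd, Category.assoc, pullback.lift_snd,
      pullbackSpecIso_inv_snd_assoc, h1, Spec.map_comp,
      Category.assoc]
    rfl

instance (e : Fin 2 → Fin 2) : IsOpenImmersion (lineChartProd e) := by
  unfold lineChartProd
  infer_instance

instance (e : Fin 2 → Fin 2) : IsOpenImmersion (planeChart e) := by
  rw [planeChart_eq]
  exact inferInstanceAs (IsOpenImmersion (_ ≫ _ ≫ (lineChartProd e)))

lemma exists_mem_range_planeChart (x : ↥(pullback lineStr lineStr)) :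
    ∃ e, x ∈ Set.range (planeChart e) := by
  obtain ⟨i, hi⟩ := exists_mem_range_lineChart (pullback.fst lineStr lineStr x)
  obtain ⟨j, hj⟩ := exists_mem_range_lineChart (pullback.snd lineStr lineStr x)
  let e : Fin 2 → Fin 2 := ![i, j]
  have h1 : x ∈ Set.range (lineChartProd e) := by
    rw [lineChartProd, Scheme.Pullback.range_map]
    exact ⟨hi, hj⟩
  obtain ⟨y, hy⟩ := h1
  refine ⟨e, ?_⟩
  rw [planeChart_eq]
  have hsurj : Function.Surjective (Spec.map tensorEquivPlaneRing.toRingEquiv.toCommRingCatIso.hom ≫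
      (pullbackSpecIso ℚ (Polynomial ℚ) (Polynomial ℚ)).inv) :=
    Scheme.Hom.surjective _
  obtain ⟨z, hz⟩ := hsurj y
  refine ⟨z, ?_⟩
  rw [← Category.assoc, Scheme.Hom.comp_apply, hz, hy]

/-- The generic point `([1 : s], [1 : t])` of `ℙ¹ × ℙ¹`. -/
noncomputable def planeGenericPoint : Spec (CommRingCat.of PlaneField) ⟶ pullback lineStr lineStr :=
  pullback.lift (f := lineStr) (g := lineStr)
    (linePoint (coordFn 0)) (linePoint (coordFn 1)) ((subsingleton_hom_spec_rat _).elim _ _)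

lemma map_chartHom_comp_lineChart (e : Fin 2 → Fin 2) (k : Fin 2) :
    Spec.map (CommRingCat.ofHom (chartHom e : PlaneRing →+* PlaneField)) ≫
      Spec.map (CommRingCat.ofHom (planeIncl k : Polynomial ℚ →+* PlaneRing)) ≫ lineChart (e k) =
      linePoint (coordFn k) := by
  rw [← Category.assoc, ← Spec.map_comp, ← CommRingCat.ofHom_comp]
  exact map_comp_lineChart (e k) (coordFn_ne_zero k) ((chartHom e).comp (planeIncl k))
    (by simp [planeIncl, chartHom_X])

/-- The atlas of `ℙ¹ × ℙ¹` by its four standard affine charts. -/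
noncomputable def planeAtlas : FieldAtlas (pullback lineStr lineStr) PlaneField where
  ι := Fin 2 → Fin 2
  ring _ := CommRingCat.of PlaneRing
  emb e := CommRingCat.ofHom (chartHom e : PlaneRing →+* PlaneField)
  chart := planeChart
  pt := planeGenericPoint
  isOpenImmersion := fun _ ↦ inferInstance
  emb_injective := chartHom_injective
  map_emb_chart e := by
    apply pullback.hom_ext
    · rw [planeGenericPoint, Category.assoc, planeChart, pullback.lift_fst, pullback.lift_fst,
        map_chartHom_comp_lineChart]
    · rw [planeGenericPoint, Category.assoc, planeChart, pullback.lift_snd, pullback.lift_snd,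
        map_chartHom_comp_lineChart]
  exists_chart := exists_mem_range_planeChart

/-- The atlas of the projective line by its two standard affine charts, embedded into `ℚ(s, t)`
by the first coordinate. -/
noncomputable def lineAtlas : FieldAtlas (Proj coordGrading) PlaneField where
  ι := Fin 2
  ring _ := CommRingCat.of (Polynomial ℚ)
  emb i := CommRingCat.ofHom (((chartHom fun _ ↦ i).comp (planeIncl 0) :
    Polynomial ℚ →ₐ[ℚ] PlaneField) : Polynomial ℚ →+* PlaneField)
  chart := lineChart
  pt := linePoint (coordFn 0)
  isOpenImmersion := fun _ ↦ inferInstance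
  emb_injective i := (chartHom_injective _).comp
    (transcendental_iff_injective.mp (MvPolynomial.transcendental_X ℚ 0))
  map_emb_chart i := map_comp_lineChart i (coordFn_ne_zero 0) _ (by simp [planeIncl, chartHom_X])
  exists_chart := exists_mem_range_lineChart

instance : (pullback lineStr lineStr).IsSeparated := by
  have h1 : IsSeparated (lineStr ≫ terminal.from _) := by
    rw [Subsingleton.elim (lineStr ≫ terminal.from _) (terminal.from (Proj coordGrading))]
    exact Scheme.IsSeparated.isSeparated_terminal_from
  have h2 : IsSeparated lineStr := IsSeparated.of_comp lineStr (terminal.from _)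
  constructor
  rw [Subsingleton.elim (terminal.from (pullback lineStr lineStr))
    (pullback.fst lineStr lineStr ≫ terminal.from (Proj coordGrading))]
  infer_instance

instance : projLineSq.left.IsSeparated :=
  inferInstanceAs (pullback lineStr lineStr).IsSeparated

lemma chartHom_zero (p : PlaneRing) :
    chartHom (fun _ ↦ 0) p = algebraMap PlaneRing PlaneField p := by
  have : chartHom (fun _ ↦ 0) = IsScalarTower.toAlgHom ℚ PlaneRing PlaneField := by
    ext i
    simp [chartHom_X, chartSign, coordFn]
  rw [this]; rfl

lemma isFractionChart_planeAtlas :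
    FieldAtlas.IsFractionChart (X := projLineSq.left) planeAtlas (fun _ : Fin 2 ↦ (0 : Fin 2)) := by
  intro f
  obtain ⟨p, q, hq, rfl⟩ := IsFractionRing.div_surjective (A := PlaneRing) f
  refine ⟨p, q, nonZeroDivisors.ne_zero (M₀ := PlaneRing) hq, ?_⟩
  change _ * chartHom (fun _ ↦ 0) q = chartHom (fun _ ↦ 0) p
  rw [chartHom_zero, chartHom_zero, div_mul_cancel₀]
  rw [Ne, IsFractionRing.to_map_eq_zero_iff]
  exact nonZeroDivisors.ne_zero hq

/-- A finite group of automorphisms of `ℙ¹ × ℙ¹` over `ℚ` has order at most `288`. -/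
theorem card_le_of_finite_subgroup_aut (G : Subgroup (Aut projLineSq)) [Finite G] :
    Nat.card G ≤ 288 := by
  obtain ⟨Φ, hinj, hΦ⟩ := FieldAtlas.exists_action_on_field (Y := projLineSq) planeAtlas
    isFractionChart_planeAtlas
  have hfin : Finite (G.map Φ) := Finite.of_equiv _ (G.equivMapOfInjective Φ hinj).toEquiv
  rw [Nat.card_congr (G.equivMapOfInjective Φ hinj).toEquiv]
  refine card_le_of_preserves_regularDerivations (G.map Φ) ?_
  rintro _ ⟨σ, -, rfl⟩ D hD e f ⟨p, rfl⟩
  exact planeAtlas.conj_derivation_mem_range D hD ((Over.forget _).mapIso σ) (Φ σ) (hΦ σ) e _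
    ⟨p, rfl⟩

/-! ### Projective linear automorphisms of the projective line -/

/-- The linear substitution `x_i ↦ ∑ j, M i j * x_j` of the homogeneous coordinates. -/
noncomputable def linSubst (M : Matrix (Fin 2) (Fin 2) ℚ) : coordGrading →+*ᵍ coordGrading where
  toRingHom := (MvPolynomial.aeval fun i ↦ ∑ j, MvPolynomial.C (M i j) * MvPolynomial.X j :
    MvPolynomial (Fin 2) ℚ →ₐ[ℚ] MvPolynomial (Fin 2) ℚ).toRingHom
  map_mem {n x} hx := by
    have := MvPolynomial.IsHomogeneous.aeval ((MvPolynomial.mem_homogeneousSubmodule n x).mp hx)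
      (fun i ↦ ∑ j, MvPolynomial.C (M i j) * MvPolynomial.X j) (n := 1) fun i ↦
        MvPolynomial.IsHomogeneous.sum _ _ _ fun j _ ↦ by
          simpa using (MvPolynomial.isHomogeneous_C (Fin 2) (M i j)).mul
            (MvPolynomial.isHomogeneous_X ℚ j)
    rw [one_mul] at this
    exact this

lemma linSubst_X (M : Matrix (Fin 2) (Fin 2) ℚ) (i : Fin 2) :
    linSubst M (.X i) = ∑ j, MvPolynomial.C (M i j) * MvPolynomial.X j :=
  MvPolynomial.aeval_X _ _

lemma linSubst_C (M : Matrix (Fin 2) (Fin 2) ℚ) (a : ℚ) : linSubst M (.C a) = .C a :=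
  MvPolynomial.aeval_C _ _

lemma linSubst_comp (M N : Matrix (Fin 2) (Fin 2) ℚ) :
    (linSubst N).comp (linSubst M) = linSubst (M * N) := by
  apply DFunLike.coe_injective
  have : (linSubst N).toRingHom.comp (linSubst M).toRingHom = (linSubst (M * N)).toRingHom := by
    refine MvPolynomial.ringHom_ext' (Subsingleton.elim _ _) fun i ↦ ?_
    change linSubst N (linSubst M (.X i)) = linSubst (M * N) (.X i)
    rw [linSubst_X, linSubst_X]
    simp only [Fin.sum_univ_two, map_add, map_mul, linSubst_C, linSubst_X, Matrix.mul_apply]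
    ring
  exact funext fun x ↦ RingHom.congr_fun this x

lemma linSubst_one : linSubst 1 = GradedRingHom.id coordGrading := by
  apply DFunLike.coe_injective
  have : (linSubst 1).toRingHom = RingHom.id _ := by
    refine MvPolynomial.ringHom_ext' (Subsingleton.elim _ _) fun i ↦ ?_
    change linSubst 1 (.X i) = .X i
    rw [linSubst_X, Finset.sum_eq_single i]
    · simp
    · intro j _ hj; simp [Matrix.one_apply_ne' hj]
    · simp
  exact funext fun x ↦ RingHom.congr_fun this x

lemma irrelevant_le_map_linSubst (M : GL (Fin 2) ℚ) :
    HomogeneousIdeal.irrelevant coordGrading ≤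
      (HomogeneousIdeal.irrelevant coordGrading).map (linSubst M.1) := by
  refine (HomogeneousIdeal.toIdeal_irrelevant_le coordGrading).mpr fun i hi x hx ↦ ?_
  have h1 : linSubst M.1 (linSubst M.inv x) = x := by
    have := linSubst_comp M.inv M.1
    rw [M.inv_val, linSubst_one] at this
    exact DFunLike.congr_fun this x
  rw [← h1]
  exact Ideal.mem_map_of_mem (linSubst M.1)
    (HomogeneousIdeal.mem_irrelevant_of_mem coordGrading hi ((linSubst M.inv).map_mem hx))

lemma proj_map_congr {f g : coordGrading →+*ᵍ coordGrading} (h : f = g)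
    (hf : HomogeneousIdeal.irrelevant coordGrading ≤
      (HomogeneousIdeal.irrelevant coordGrading).map f)
    (hg : HomogeneousIdeal.irrelevant coordGrading ≤
      (HomogeneousIdeal.irrelevant coordGrading).map g) : Proj.map f hf = Proj.map g hg := by
  subst h; rfl

/-- The morphism of the projective line given by an invertible matrix. -/
noncomputable def linMap (M : GL (Fin 2) ℚ) : Proj coordGrading ⟶ Proj coordGrading :=
  Proj.map (linSubst M.1) (irrelevant_le_map_linSubst M)

lemma linMap_mul (M N : GL (Fin 2) ℚ) : linMap (M * N) = linMap N ≫ linMap M := by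
  have h : linSubst (M * N).1 = (linSubst N.1).comp (linSubst M.1) := by
    rw [Units.val_mul, linSubst_comp]
  have h1 : Proj.map ((linSubst N.1).comp (linSubst M.1))
      (HomogeneousIdeal.irrelevant_le_map_comp (irrelevant_le_map_linSubst M)
        (irrelevant_le_map_linSubst N)) = linMap N ≫ linMap M :=
    Proj.map_comp _ _ _ _
  rw [← h1, linMap]
  exact proj_map_congr h _ _

lemma linMap_one : linMap 1 = 𝟙 _ :=
  (proj_map_congr linSubst_one (irrelevant_le_map_linSubst 1)
    (linSubst_one ▸ irrelevant_le_map_linSubst 1)).trans Proj.map_id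

/-- The projective linear automorphism of the projective line given by an invertible matrix. -/
noncomputable def projLinear : GL (Fin 2) ℚ →* Aut projLine :=
  MonoidHom.mk' (fun M ↦
    { hom := Over.homMk (linMap M) ((subsingleton_hom_spec_rat _).elim _ _)
      inv := Over.homMk (linMap M⁻¹) ((subsingleton_hom_spec_rat _).elim _ _)
      hom_inv_id := by
        apply Over.OverMorphism.ext
        change linMap M ≫ linMap M⁻¹ = 𝟙 _
        rw [← linMap_mul, inv_mul_cancel, linMap_one]
      inv_hom_id := by
        apply Over.OverMorphism.ext
        change linMap M⁻¹ ≫ linMap M = 𝟙 _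
        rw [← linMap_mul, mul_inv_cancel, linMap_one] }) fun M N ↦ by
    apply Iso.ext
    apply Over.OverMorphism.ext
    exact linMap_mul M N

/-- The matrix acts on the affine coordinate by a fractional linear transformation. -/
lemma linePoint_comp_linMap {K : Type} [Field K] [Algebra ℚ K] (x : K) (M : GL (Fin 2) ℚ)
    (h : (M.1 0 0 : K) + (M.1 0 1 : K) * x ≠ 0) :
    linePoint x ≫ linMap M =
      linePoint (((M.1 1 0 : K) + (M.1 1 1 : K) * x) / ((M.1 0 0 : K) + (M.1 0 1 : K) * x)) := by
  have hu : ∀ i, MvPolynomial.aeval (![1, x] : Fin 2 → K) (linSubst M.1 (.X i)) =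
      (M.1 i 0 : K) + (M.1 i 1 : K) * x := by
    intro i
    rw [linSubst_X]
    simp [Fin.sum_univ_two]
  set a := (M.1 0 0 : K) + (M.1 0 1 : K) * x with ha
  have h0 : IsUnit (MvPolynomial.aeval (![1, x] : Fin 2 → K) (linSubst M.1 (.X 0))) := by
    rw [hu]; exact h.isUnit
  have h1 : IsUnit (MvPolynomial.aeval
      (fun i ↦ MvPolynomial.aeval (![1, x] : Fin 2 → K) (linSubst M.1 (.X i)))
      (MvPolynomial.X 0 : MvPolynomial (Fin 2) ℚ)) := by
    rw [MvPolynomial.aeval_X]; exact h0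
  have e1 : linePoint x = pointOf ![1, x] (linSubst M.1 (.X 0))
      ((linSubst M.1).map_mem (X_mem_coordGrading 0)) h0 := pointOf_eq_pointOf _ _ _ _ _
  rw [e1]
  refine (pointOf_comp_map ![1, x] (linSubst M.1) (irrelevant_le_map_linSubst M)
    (X_mem_coordGrading 0) h0 h1).trans ?_
  have h2 : (fun i ↦ MvPolynomial.aeval (![1, x] : Fin 2 → K) (linSubst M.1 (.X i))) =
      fun i ↦ a * (![1, ((M.1 1 0 : K) + (M.1 1 1 : K) * x) / a] : Fin 2 → K) i := by
    funext i
    rw [hu]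
    fin_cases i
    · simp [ha]
    · simp [mul_div_cancel₀ _ h]
  simp only [h2]
  exact pointOf_smul _ h.isUnit _ _ _

lemma linePoint_injective {K : Type} [Field K] [Algebra ℚ K] :
    Function.Injective (linePoint : K → _) := by
  intro x y h
  have := eq_of_pointOf_eq _ _ h
  simpa using this

/-- A projective linear automorphism is trivial exactly if its matrix is scalar. -/
lemma projLinear_eq_one_iff (M : GL (Fin 2) ℚ) :
    projLinear M = 1 ↔ M.1 0 1 = 0 ∧ M.1 1 0 = 0 ∧ M.1 0 0 = M.1 1 1 := by
  have hq := isQuadFree_of_transcendental (transcendental_coordFn 0)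
  have hdet : M.1.det ≠ 0 := M.1.isUnit_iff_isUnit_det.mp M.isUnit |>.ne_zero
  rw [Matrix.det_fin_two] at hdet
  have hne : (M.1 0 0 : PlaneField) + (M.1 0 1 : PlaneField) * coordFn 0 ≠ 0 := by
    intro h
    obtain ⟨-, h1, h2⟩ := hq 0 (M.1 0 1) (M.1 0 0) (by
      rw [Rat.cast_zero, zero_mul, zero_add, add_comm]; exact h)
    exact hdet (by rw [h1, h2]; ring)
  have h1 : projLinear M = 1 ↔ linMap M = 𝟙 _ := by
    refine ⟨fun h ↦ ?_, fun h ↦ ?_⟩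
    · exact congrArg (fun σ : Aut projLine ↦ σ.hom.left) h
    · exact Iso.ext (Over.OverMorphism.ext h)
  have h2 : linMap M = 𝟙 _ ↔ linePoint (coordFn 0) ≫ linMap M = linePoint (coordFn 0) := by
    refine ⟨fun h ↦ by rw [h, Category.comp_id], fun h ↦ lineAtlas.hom_ext ?_⟩
    exact h.trans (Category.comp_id _).symm
  rw [h1, h2, linePoint_comp_linMap _ _ hne, linePoint_injective.eq_iff, div_eq_iff hne]
  refine ⟨fun h ↦ ?_, fun ⟨e1, e2, e3⟩ ↦ ?_⟩
  · obtain ⟨e1, e2, e3⟩ := hq (M.1 0 1) (M.1 0 0 - M.1 1 1) (-M.1 1 0) (by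
      push_cast; linear_combination -h)
    exact ⟨e1, by linarith, by linarith⟩
  · rw [e1, e2, e3]; ring

/-! ### The dihedral group of order twelve in `PGL₂(ℚ)` -/

/-- A homomorphism from a dihedral group is given by an element `a` with `a ^ n = 1` and an
involution `b` with `b a b = a⁻¹`. -/
lemma exists_dihedralGroup_hom {G : Type*} [Group G] {n : ℕ} (a b : G) (ha : a ^ n = 1)
    (hb : b * b = 1) (hab : b * a * b = a⁻¹) :
    ∃ f : DihedralGroup n →* G, f (.r 1) = a ∧ f (.sr 0) = b := by
  let φ : ZMod n →+ Additive G :=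
    ZMod.lift n ⟨zmultiplesHom (Additive G) (Additive.ofMul a), by
      simp [← ofMul_pow, ha]⟩
  have hφint : ∀ k : ℤ, (φ k).toMul = a ^ k := by
    intro k
    simp [φ]
  have hconj : ∀ i : ZMod n, b * (φ i).toMul = (φ (-i)).toMul * b := by
    intro i
    obtain ⟨k, rfl⟩ := ZMod.intCast_surjective i
    have hb' : b⁻¹ = b := inv_eq_of_mul_eq_one_left hb
    have h0 : b * a * b⁻¹ = a⁻¹ := by rw [hb', hab]
    have h1 : b * a ^ k * b⁻¹ = a⁻¹ ^ k := by rw [← h0, conj_zpow]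
    rw [← Int.cast_neg, hφint, hφint, zpow_neg, ← inv_zpow, ← h1, inv_mul_cancel_right]
  refine ⟨MonoidHom.mk' (fun x ↦ match x with
    | .r i => (φ i).toMul
    | .sr i => b * (φ i).toMul) ?_, ?_, ?_⟩
  · rintro (i | i) (j | j)
    · simp only [DihedralGroup.r_mul_r, map_add, toMul_add]
    · simp only [DihedralGroup.r_mul_sr]
      rw [← mul_assoc, sub_eq_neg_add, map_add, toMul_add, ← mul_assoc, hconj, neg_neg]
    · simp only [DihedralGroup.sr_mul_r, map_add, toMul_add, mul_assoc]
    · simp only [DihedralGroup.sr_mul_sr]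
      rw [hconj i, mul_assoc, ← mul_assoc b b, hb, one_mul, sub_eq_neg_add, map_add, toMul_add]
  · have := hφint 1
    simpa using this
  · simp

/-- Every nontrivial normal subgroup of the dihedral group of order `12` contains the rotation of
order three or the rotation of order two. -/
lemma injective_of_dihedralGroup_six {G : Type*} [Group G] (f : DihedralGroup 6 →* G)
    (h2 : f (.r 2) ≠ 1) (h3 : f (.r 3) ≠ 1) : Function.Injective f := by
  rw [injective_iff_map_eq_one]
  intro x hx
  by_contra hne
  have key : ∀ x : DihedralGroup 6, x ≠ 1 → x * (.r 1 * x⁻¹ * (.r 1)⁻¹) = .r 2 ∨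
      x * (.r 1 * x⁻¹ * (.r 1)⁻¹) = .r 4 ∨ (∃ k : Fin 6, x ^ (k : ℕ) = .r 2) ∨ x = .r 3 := by
    decide
  have h4 : f (.r 4) ≠ 1 := by
    intro h
    apply h2
    have : (.r 2 : DihedralGroup 6) = .r 4 * .r 4 := by decide
    rw [this, map_mul, h, one_mul]
  rcases key x hne with h | h | ⟨k, h⟩ | h
  · exact h2 (by rw [← h]; simp only [map_mul, map_inv, hx]; group)
  · exact h4 (by rw [← h]; simp only [map_mul, map_inv, hx]; group)
  · exact h2 (by rw [← h, map_pow, hx, one_pow])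
  · exact h3 (by rw [← h, hx])

/-- The dihedral group of order `12` embeds into the automorphism group of the projective line: the
matrix `!![2, -1; 1, 1]` has eigenvalue ratio a primitive sixth root of unity, and exchanging the
coordinates inverts it up to a scalar. -/
lemma exists_dihedralGroup_embedding :
    ∃ ρ : DihedralGroup 6 →* Aut projLine, Function.Injective ρ := by
  let A : GL (Fin 2) ℚ := Matrix.GeneralLinearGroup.mkOfDetNeZero !![2, -1; 1, 1] (by
    rw [Matrix.det_fin_two_of]; norm_num)
  let B : GL (Fin 2) ℚ := Matrix.GeneralLinearGroup.mkOfDetNeZero !![0, 1; 1, 0] (by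
    rw [Matrix.det_fin_two_of]; norm_num)
  have hA : A.1 = !![2, -1; 1, 1] := rfl
  have hB : B.1 = !![0, 1; 1, 0] := rfl
  have hA2 : (A ^ 2).1 = !![3, -3; 3, 0] := by
    rw [Units.val_pow_eq_pow_val, hA, sq, Matrix.mul_fin_two]; norm_num
  have hA3 : (A ^ 3).1 = !![3, -6; 6, -3] := by
    rw [pow_succ, Units.val_mul, hA2, hA, Matrix.mul_fin_two]; norm_num
  have hA6 : (A ^ 6).1 = !![-27, 0; 0, -27] := by
    rw [show (6 : ℕ) = 3 + 3 from rfl, pow_add, Units.val_mul, hA3, Matrix.mul_fin_two]; norm_num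
  have hBB : (B * B).1 = !![1, 0; 0, 1] := by
    rw [Units.val_mul, hB, Matrix.mul_fin_two]; norm_num
  have hBA : (B * A * B * A).1 = !![3, 0; 0, 3] := by
    rw [Units.val_mul, Units.val_mul, Units.val_mul, hA, hB, Matrix.mul_fin_two,
      Matrix.mul_fin_two, Matrix.mul_fin_two]; norm_num
  obtain ⟨ρ, hρ, -⟩ := exists_dihedralGroup_hom (n := 6) (projLinear A) (projLinear B)
    (by rw [← map_pow, projLinear_eq_one_iff, hA6]; simp)
    (by rw [← map_mul, projLinear_eq_one_iff, hBB]; simp)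
    (by
      rw [← mul_eq_one_iff_eq_inv, ← map_mul, ← map_mul, ← map_mul, projLinear_eq_one_iff, hBA]
      simp)
  refine ⟨ρ, injective_of_dihedralGroup_six ρ ?_ ?_⟩
  · rw [show (.r 2 : DihedralGroup 6) = .r 1 ^ 2 by decide, map_pow, hρ, ← map_pow, Ne,
      projLinear_eq_one_iff, hA2]
    simp
  · rw [show (.r 3 : DihedralGroup 6) = .r 1 ^ 3 by decide, map_pow, hρ, ← map_pow, Ne,
      projLinear_eq_one_iff, hA3]
    simp

/-! ### Automorphisms of the square of an object -/

section Square

universe v u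

variable {C : Type u} [Category.{v} C] {L P : C} {p q : P ⟶ L}

/-- The morphism into the square `P` of `L` with components `f` and `g`. -/
def squareLift (h : IsLimit (BinaryFan.mk p q)) {Z : C} (f g : Z ⟶ L) : Z ⟶ P :=
  h.lift (BinaryFan.mk f g)

@[simp] lemma squareLift_fst (h : IsLimit (BinaryFan.mk p q)) {Z : C} (f g : Z ⟶ L) :
    squareLift h f g ≫ p = f :=
  h.fac (BinaryFan.mk f g) ⟨WalkingPair.left⟩

@[simp] lemma squareLift_snd (h : IsLimit (BinaryFan.mk p q)) {Z : C} (f g : Z ⟶ L) :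
    squareLift h f g ≫ q = g :=
  h.fac (BinaryFan.mk f g) ⟨WalkingPair.right⟩

lemma square_hom_ext (h : IsLimit (BinaryFan.mk p q)) {Z : C} {f g : Z ⟶ P}
    (h1 : f ≫ p = g ≫ p) (h2 : f ≫ q = g ≫ q) : f = g :=
  BinaryFan.IsLimit.hom_ext h h1 h2

/-- The automorphism `a × b` of the square of an object. -/
def prodAut (h : IsLimit (BinaryFan.mk p q)) : Aut L × Aut L →* Aut P :=
  MonoidHom.mk' (fun x ↦
    { hom := squareLift h (p ≫ x.1.hom) (q ≫ x.2.hom)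
      inv := squareLift h (p ≫ x.1.inv) (q ≫ x.2.inv)
      hom_inv_id := by
        apply square_hom_ext h
        · rw [Category.assoc, squareLift_fst, ← Category.assoc, squareLift_fst,
            Category.assoc, Iso.hom_inv_id x.1, Category.id_comp, Category.comp_id]
        · rw [Category.assoc, squareLift_snd, ← Category.assoc, squareLift_snd,
            Category.assoc, Iso.hom_inv_id x.2, Category.id_comp, Category.comp_id]
      inv_hom_id := by
        apply square_hom_ext h
        · rw [Category.assoc, squareLift_fst, ← Category.assoc, squareLift_fst,
            Category.assoc, Iso.inv_hom_id x.1, Category.id_comp, Category.comp_id]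
        · rw [Category.assoc, squareLift_snd, ← Category.assoc, squareLift_snd,
            Category.assoc, Iso.inv_hom_id x.2, Category.id_comp, Category.comp_id] }) fun x y ↦ by
    apply Iso.ext
    apply square_hom_ext h
    · change squareLift h _ _ ≫ p = (squareLift h _ _ ≫ squareLift h _ _) ≫ p
      rw [Category.assoc, squareLift_fst, squareLift_fst, ← Category.assoc, squareLift_fst,
        Category.assoc]
      rfl
    · change squareLift h _ _ ≫ q = (squareLift h _ _ ≫ squareLift h _ _) ≫ q
      rw [Category.assoc, squareLift_snd, squareLift_snd, ← Category.assoc, squareLift_snd,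
        Category.assoc]
      rfl

lemma prodAut_hom_fst (h : IsLimit (BinaryFan.mk p q)) (x : Aut L × Aut L) :
    (prodAut h x).hom ≫ p = p ≫ x.1.hom :=
  squareLift_fst h _ _

lemma prodAut_hom_snd (h : IsLimit (BinaryFan.mk p q)) (x : Aut L × Aut L) :
    (prodAut h x).hom ≫ q = q ≫ x.2.hom :=
  squareLift_snd h _ _

/-- The exchange of the two factors of the square of an object. -/
def swapAut (h : IsLimit (BinaryFan.mk p q)) : Aut P :=
  have hinv : squareLift h q p ≫ squareLift h q p = 𝟙 P := by
    apply square_hom_ext h <;> simp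
  { hom := squareLift h q p
    inv := squareLift h q p
    hom_inv_id := hinv
    inv_hom_id := hinv }

lemma swapAut_hom_fst (h : IsLimit (BinaryFan.mk p q)) : (swapAut h).hom ≫ p = q :=
  squareLift_fst h _ _

lemma swapAut_hom_snd (h : IsLimit (BinaryFan.mk p q)) : (swapAut h).hom ≫ q = p :=
  squareLift_snd h _ _

lemma swapAut_mul_self (h : IsLimit (BinaryFan.mk p q)) : swapAut h * swapAut h = 1 :=
  Iso.ext (swapAut h).hom_inv_id

lemma swapAut_mul_prodAut (h : IsLimit (BinaryFan.mk p q)) (x : Aut L × Aut L) :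
    swapAut h * prodAut h x = prodAut h x.swap * swapAut h := by
  apply Iso.ext
  apply square_hom_ext h
  · change ((prodAut h x).hom ≫ (swapAut h).hom) ≫ p = ((swapAut h).hom ≫ (prodAut h _).hom) ≫ p
    rw [Category.assoc, Category.assoc, swapAut_hom_fst, prodAut_hom_snd, prodAut_hom_fst,
      ← Category.assoc, swapAut_hom_fst]
    rfl
  · change ((prodAut h x).hom ≫ (swapAut h).hom) ≫ q = ((swapAut h).hom ≫ (prodAut h _).hom) ≫ q
    rw [Category.assoc, Category.assoc, swapAut_hom_snd, prodAut_hom_snd, prodAut_hom_fst,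
      ← Category.assoc, swapAut_hom_snd]
    rfl

/-- The action of `ℤ/2` on the square of an object that exchanges the two factors. -/
def swapHom (h : IsLimit (BinaryFan.mk p q)) : Multiplicative (ZMod 2) →* Aut P :=
  MonoidHom.mk' (fun t ↦ if t = 1 then 1 else swapAut h) fun s t ↦ by
    have key : ∀ s t : Multiplicative (ZMod 2),
        (s = 1 ∧ s * t = t) ∨ (t = 1 ∧ s * t = s) ∨ (s ≠ 1 ∧ t ≠ 1 ∧ s * t = 1) := by decide
    rcases key s t with ⟨hs, h⟩ | ⟨ht, h⟩ | ⟨hs, ht, h⟩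
    · rw [h]; simp [hs]
    · rw [h]; simp [ht]
    · rw [h, if_pos rfl, if_neg hs, if_neg ht, swapAut_mul_self]

lemma swapHom_apply_of_ne (h : IsLimit (BinaryFan.mk p q)) {t : Multiplicative (ZMod 2)}
    (ht : t ≠ 1) : swapHom h t = swapAut h :=
  if_neg ht

/-- The action of `(D × D) ⋊ ℤ/2` on the square of an object with an action of `D`. -/
def wreathHom (h : IsLimit (BinaryFan.mk p q)) {D : Type} [Group D] (ρ : D →* Aut L) :
    (D × D) ⋊[swapAction D] Multiplicative (ZMod 2) →* Aut P :=
  SemidirectProduct.lift ((prodAut h).comp (ρ.prodMap ρ)) (swapHom h) fun t ↦ by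
    by_cases ht : t = 1
    · subst ht
      ext1 x
      simp
    · refine MonoidHom.ext fun x ↦ ?_
      have h1 : swapAction D t = MulEquiv.prodComm := if_neg ht
      change prodAut h (ρ.prodMap ρ (swapAction D t x)) = swapHom h t *
        prodAut h (ρ.prodMap ρ x) * (swapHom h t)⁻¹
      rw [h1, swapHom_apply_of_ne h ht, swapAut_mul_prodAut, mul_inv_cancel_right]
      rfl

lemma wreathHom_inl (h : IsLimit (BinaryFan.mk p q)) {D : Type} [Group D] (ρ : D →* Aut L)
    (x : D × D) : wreathHom h ρ (SemidirectProduct.inl x) = prodAut h (ρ x.1, ρ x.2) :=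
  SemidirectProduct.lift_inl _ _ _ _

lemma wreathHom_inr (h : IsLimit (BinaryFan.mk p q)) {D : Type} [Group D] (ρ : D →* Aut L)
    {t : Multiplicative (ZMod 2)} (ht : t ≠ 1) :
    wreathHom h ρ (SemidirectProduct.inr t) = swapAut h :=
  (SemidirectProduct.lift_inr _ _ _ _).trans (swapHom_apply_of_ne h ht)

/-- The action of `(D × D) ⋊ ℤ/2` on the square of an object `L` is faithful if `D` is nontrivial
and acts faithfully on `L`: an element exchanging the factors and acting trivially would make
any two morphisms to `L` differ by a fixed automorphism of `L`. -/
lemma wreathHom_injective (h : IsLimit (BinaryFan.mk p q)) {D : Type} [Group D] [Nontrivial D]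
    {ρ : D →* Aut L} (hρ : Function.Injective ρ) : Function.Injective (wreathHom h ρ) := by
  rw [injective_iff_map_eq_one]
  rintro x hx
  rw [← SemidirectProduct.inl_left_mul_inr_right x] at hx ⊢
  obtain ⟨⟨a, b⟩, t⟩ := x
  simp only at hx ⊢
  by_cases ht : t = 1
  · subst ht
    rw [map_one, mul_one, wreathHom_inl] at hx
    have h1 : p ≫ (ρ a).hom = p := by
      rw [← prodAut_hom_fst h (ρ a, ρ b), hx]; exact Category.id_comp p
    have h2 : q ≫ (ρ b).hom = q := by
      rw [← prodAut_hom_snd h (ρ a, ρ b), hx]; exact Category.id_comp q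
    have h3 : (ρ a).hom = 𝟙 L := by
      have := congrArg (squareLift h (𝟙 L) (𝟙 L) ≫ ·) h1
      simpa only [← Category.assoc, squareLift_fst, Category.id_comp] using this
    have h4 : (ρ b).hom = 𝟙 L := by
      have := congrArg (squareLift h (𝟙 L) (𝟙 L) ≫ ·) h2
      simpa only [← Category.assoc, squareLift_snd, Category.id_comp] using this
    have ha : a = 1 := (injective_iff_map_eq_one ρ).mp hρ a (Iso.ext h3)
    have hb : b = 1 := (injective_iff_map_eq_one ρ).mp hρ b (Iso.ext h4)
    rw [ha, hb, map_one, mul_one]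
    exact map_one _
  · exfalso
    rw [map_mul, wreathHom_inl, wreathHom_inr h ρ ht] at hx
    have h1 : q ≫ (ρ a).hom = p := by
      have h2 : ((swapAut h).hom ≫ (prodAut h (ρ a, ρ b)).hom) ≫ p = 𝟙 P ≫ p :=
        congrArg (fun σ : Aut P ↦ σ.hom ≫ p) hx
      rwa [Category.assoc, prodAut_hom_fst, ← Category.assoc, swapAut_hom_fst,
        Category.id_comp] at h2
    have h3 : ∀ f : L ⟶ L, (ρ a).hom = f := fun f ↦ by
      have := congrArg (squareLift h f (𝟙 L) ≫ ·) h1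
      simpa only [← Category.assoc, squareLift_fst, squareLift_snd, Category.id_comp] using this
    obtain ⟨d, hd⟩ := exists_ne (1 : D)
    exact hd ((injective_iff_map_eq_one ρ).mp hρ d (Iso.ext ((h3 (ρ d).hom).symm.trans (h3 (𝟙 L)))))

end Square

/-- The surface `ℙ¹ × ℙ¹` is the categorical product of two copies of `ℙ¹` over `ℚ`. -/
noncomputable def isLimitProjLineSq : IsLimit (BinaryFan.mk projLineSqFst projLineSqSnd) :=
  BinaryFan.isLimitMk
    (fun s ↦ Over.homMk (pullback.lift s.fst.left s.snd.left
      ((subsingleton_hom_spec_rat _).elim _ _)) ((subsingleton_hom_spec_rat _).elim _ _))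
    (fun _ ↦ Over.OverMorphism.ext (pullback.lift_fst _ _ _))
    (fun _ ↦ Over.OverMorphism.ext (pullback.lift_snd _ _ _))
    (fun _ _ h1 h2 ↦ Over.OverMorphism.ext (pullback.hom_ext
      ((congrArg CommaMorphism.left h1).trans (pullback.lift_fst _ _ _).symm)
      ((congrArg CommaMorphism.left h2).trans (pullback.lift_snd _ _ _).symm)))

lemma card_dihedralSwapGroup : Nat.card dihedralSwapGroup = 288 := by
  rw [Nat.card_congr SemidirectProduct.equivProd, Nat.card_prod, Nat.card_prod,
    DihedralGroup.nat_card, Nat.card_congr Multiplicative.toAdd, Nat.card_zmod]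

theorem mainTheorem5 :
    (∀ G : Subgroup (Aut projLineSq), Finite G → Nat.card G ≤ 288) ∧
    ∃ (ρ : DihedralGroup 6 →* Aut projLine) (Φ : dihedralSwapGroup →* Aut projLineSq),
      Function.Injective ρ ∧ Function.Injective Φ ∧
      (∀ a b : DihedralGroup 6,
        (Φ (SemidirectProduct.inl (a, b))).hom ≫ projLineSqFst = projLineSqFst ≫ (ρ a).hom ∧
        (Φ (SemidirectProduct.inl (a, b))).hom ≫ projLineSqSnd = projLineSqSnd ≫ (ρ b).hom) ∧
      (Φ (SemidirectProduct.inr (Multiplicative.ofAdd 1))).hom ≫ projLineSqFst = projLineSqSnd ∧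
      (Φ (SemidirectProduct.inr (Multiplicative.ofAdd 1))).hom ≫ projLineSqSnd = projLineSqFst ∧
      Finite Φ.range ∧ Nat.card Φ.range = 288 := by
  refine ⟨fun G _ ↦ card_le_of_finite_subgroup_aut G, ?_⟩
  obtain ⟨ρ, hρ⟩ := exists_dihedralGroup_embedding
  have hinj := wreathHom_injective isLimitProjLineSq hρ
  have hcard : Nat.card (wreathHom isLimitProjLineSq ρ).range = 288 :=
    (Nat.card_congr (MonoidHom.ofInjective hinj).toEquiv).symm.trans card_dihedralSwapGroup
  have hs := wreathHom_inr isLimitProjLineSq ρ (t := Multiplicative.ofAdd 1) (by decide)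
  refine ⟨ρ, wreathHom isLimitProjLineSq ρ, hρ, hinj, fun a b ↦ ?_, ?_, ?_,
    Nat.finite_of_card_ne_zero (by rw [hcard]; decide), hcard⟩
  · rw [wreathHom_inl]
    exact ⟨prodAut_hom_fst _ _, prodAut_hom_snd _ _⟩
  · rw [hs, swapAut_hom_fst]
  · rw [hs, swapAut_hom_snd]
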